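/- All vector spaces are over $\mathbb C$. A *weak quantum vertex algebra* is a vector space $V$ with a linear map $Y:V\to \mathrm{Hom}(V,V((x)))$, $v\mapsto Y(v,x)$, and a vector $\mathbf 1\in V$ such that $Y(\mathbf 1,x)=1$, $Y(v,x)\mathbf 1\in V[[x]]$ with $\lim_{x\to 0}Y(v,x)\mathbf 1=v$ for all $v\in V$, and such that for all $u,v\in V$ there is $\sum_{i=1}^r v^{(i)}\otimes u^{(i)}\otimes f_i(x)\in V\otimes V\otimes\mathbb C((x))$ with $$x_0^{-1}\delta\!\left(\tfrac{x_1-x_2}{x_0}\right)Y(u,x_1)Y(v,x_2)-x_0^{-1}\delta\!\left(\tfrac{x_2-x_1}{-x_0}\right)\sum_{i=1}^r f_i(-x_0)Y(v^{(i)},x_2)Y(u^{(i)},x_1)=x_2^{-1}\delta\!\left(\tfrac{x_1-x_0}{x_2}\right)Y(Y(u,x_0)v,x_2).\qquad(\mathrm J)$$ A *unitary rational quantum Yang–Baxter operator* on $V$ is a linear map $\mathcal S(x):V\otimes V\to V\otimes V\otimes\mathbb C((x))$ such that $\mathcal S_{21}(x)\mathcal S(-x)=1$ and $$\mathcal S_{12}(x)\mathcal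 S_{13}(x+z)\mathcal S_{23}(z)=\mathcal S_{23}(z)\mathcal S_{13}(x+z)\mathcal S_{12}(x)$$ (an identity over $\mathbb C((x))((z))$, with $f(x+z)$ expanded in nonnegative powers of $z$ for $f\in\mathbb C((x))$). The pair $(V,\mathcal S)$ is a *quantum vertex algebra* if $V$ is a weak quantum vertex algebra, $\mathcal S$ is a unitary rational quantum Yang–Baxter operator on $V$, and for all $u,v\in V$ identity (J) holds with $\sum_i v^{(i)}\otimes u^{(i)}\otimes f_i(x)=\mathcal S(x)(v\otimes u)$. For $n\ge 1$ let $\pi_n^V: V^{\otimes n}\otimes\mathbb C((x_1))\cdots((x_n))\to\mathrm{Hom}(V,V((x_1))\cdots((x_n)))$ be the linear map $$\pi_n^V(v_1\otimes\cdots\otimes v_n\otimes f)(w)=f(x_1,\dots,x_n)Y(v_1,x_1)\cdots Y(v_n,x_n)w .$$ $V$ is *nondegenerate* if for every $n\ge1$ the map $V^{\otimes n}\otimes\mathbb C((x_1))\cdots((x_n))\to V((x_1))\cdots((x_n))$, $t\mapsto \pi_n^V(t)(\mathbf 1)$, is injective. **Theorem.** Let $V$ be a weak quantum vertex algebra. 1.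 Assume that $\pi_3^V$ is injective. Then there is a unique linear map $\mathcal S(x):V\otimes V\to V\otimes V\otimes\mathbb C((x))$ such that $(V,\mathcal S)$ is a quantum vertex algebra; in particular $\mathcal S$ is a unitary rational quantum Yang–Baxter operator. Moreover $\mathcal S$ is determined by $\mathcal S$-locality: whenever $u,v,u^{(i)},v^{(i)}\in V$ and $f_i\in\mathbb C((x))$ ($1\le i\le r$) satisfy, for some integer $k\ge 0$, $$(x_1-x_2)^kY(u,x_1)Y(v,x_2)=(x_1-x_2)^k\sum_{i=1}^r f_i(x_2-x_1)Y(v^{(i)},x_2)Y(u^{(i)},x_1)$$ (with $f_i(x_2-x_1)$ expanded in nonnegative powers of $x_1$), one has $\mathcal S(x)(v\otimes u)=\sum_{i=1}^r v^{(i)}\otimes u^{(i)}\otimes f_i(x)$. 2. The same conclusions hold if $V$ is nondegenerate. In particular, every nondegenerate weak quantum vertex algebra is a quantum vertex algebra with uniquely determined $\mathcal S(x)$. -/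

import Mathlib

open scoped TensorProduct

noncomputable section

namespace QVA

universe u

/-- The coefficientwise `ℂ`-algebra structure on `A((x))`, preferred over the propositionally equal
one that Mathlib transports from power series. -/
instance (priority := 2000) laurentAlgebra (A : Type) [CommRing A] [Algebra ℂ A] :
    Algebra ℂ (LaurentSeries A) :=
  HahnSeries.instAlgebra

section IteratedLaurent

/-- `IterField n` is `ℂ((x₁))((x₂))⋯((xₙ))`, as a `ℂ`-algebra; the last variable `xₙ` is the
outermost one. -/
def IterField : ℕ → CommAlgCat.{0} ℂ
  | 0 => CommAlgCat.of ℂ ℂ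
  | n + 1 => CommAlgCat.of ℂ (LaurentSeries (IterField n))

/-- `V((x₁))((x₂))⋯((xₙ))` as a bundled module over `ℂ((x₁))((x₂))⋯((xₙ))`. -/
def iterModule (V : Type u) [AddCommGroup V] [Module ℂ V] : (n : ℕ) → ModuleCat.{u} (IterField n)
  | 0 => (ModuleCat.of ℂ V : ModuleCat.{u} ℂ)
  | n + 1 => (ModuleCat.of (LaurentSeries (IterField n))
      (HahnModule ℤ (IterField n) (iterModule V n)) :
        ModuleCat.{u} (LaurentSeries (IterField n)))

/-- The space `V((x₁))((x₂))⋯((xₙ))`. -/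
def IterSeries (V : Type u) [AddCommGroup V] [Module ℂ V] (n : ℕ) : Type u :=
  iterModule V n

variable (V : Type u) [AddCommGroup V] [Module ℂ V] (n : ℕ)

instance : AddCommGroup (IterSeries V n) :=
  inferInstanceAs (AddCommGroup (iterModule V n))

instance : Module (IterField n) (IterSeries V n) :=
  inferInstanceAs (Module (IterField n) (iterModule V n))

instance : Module ℂ (IterSeries V n) :=
  Module.compHom (IterSeries V n) (algebraMap ℂ (IterField n))

instance : IsScalarTower ℂ (IterField n) (IterSeries V n) :=
  IsScalarTower.of_algebraMap_smul fun _ _ => rfl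

variable {V n}

/-- The vectors of `V((x₁))⋯((xₙ))((xₙ₊₁))` are the Laurent series in `xₙ₊₁` with coefficients
in `V((x₁))⋯((xₙ))`. -/
def toIterSucc (s : LaurentSeries (IterSeries V n)) : IterSeries V (n + 1) :=
  HahnModule.of (IterField n) (V := iterModule V n) s

/-- The coefficient of `xₙ₊₁ ^ j`. -/
def iterCoeff (s : IterSeries V (n + 1)) (j : ℤ) : IterSeries V n :=
  ((HahnModule.of (IterField n) (V := iterModule V n)).symm s).coeff j

theorem iterSucc_ext {s t : IterSeries V (n + 1)} (h : ∀ j, iterCoeff s j = iterCoeff t j) :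
    s = t :=
  HahnModule.ext (R := IterField n) (V := iterModule V n) s t (funext h)

theorem iterCoeff_add (s t : IterSeries V (n + 1)) (j : ℤ) :
    iterCoeff (s + t) j = iterCoeff s j + iterCoeff t j := rfl

theorem iterCoeff_smul (c : ℂ) (s : IterSeries V (n + 1)) (j : ℤ) :
    iterCoeff (c • s) j = c • iterCoeff s j := by
  have h := HahnModule.coeff_single_zero_smul (R := IterField n) (V := iterModule V n)
    (Γ := ℤ) (Γ' := ℤ) (r := algebraMap ℂ (IterField n) c) (x := s) (a := j)
  exact h

/-- A linear map `g : V → V((x₁))⋯((xₙ))` composed with a field `A : V → V((xₙ₊₁))`. -/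
def compField (g : V →ₗ[ℂ] IterSeries V n) (A : VertexOperator ℂ V) :
    V →ₗ[ℂ] IterSeries V (n + 1) where
  toFun w := toIterSucc (((HahnModule.of ℂ).symm (A w)).map g)
  map_add' a b := iterSucc_ext fun j => by
    rw [iterCoeff_add]
    change g (((HahnModule.of ℂ).symm (A (a + b))).coeff j) = _
    rw [map_add]
    exact map_add g _ _
  map_smul' c a := iterSucc_ext fun j => by
    rw [RingHom.id_apply, iterCoeff_smul]
    change g (((HahnModule.of ℂ).symm (A (c • a))).coeff j) = _
    rw [map_smul]
    exact map_smul g _ _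

theorem iterCoeff_compField (g : V →ₗ[ℂ] IterSeries V n) (A : VertexOperator ℂ V) (w : V) (j : ℤ) :
    iterCoeff (compField g A w) j = g (((HahnModule.of ℂ).symm (A w)).coeff j) := rfl

/-- `compField` as a bilinear map, for the fields `Y(v, xₙ₊₁)`. -/
def compFieldₗ (Y : V →ₗ[ℂ] VertexOperator ℂ V) :
    (V →ₗ[ℂ] IterSeries V n) →ₗ[ℂ] V →ₗ[ℂ] (V →ₗ[ℂ] IterSeries V (n + 1)) :=
  LinearMap.mk₂ ℂ (fun g v => compField g (Y v))
    (fun g g' v => LinearMap.ext fun w => iterSucc_ext fun j => rfl)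
    (fun c g v => LinearMap.ext fun w => iterSucc_ext fun j => by
      rw [LinearMap.smul_apply, iterCoeff_smul]; rfl)
    (fun g v v' => LinearMap.ext fun w => iterSucc_ext fun j => by
      rw [LinearMap.add_apply, iterCoeff_add]
      simp only [iterCoeff_compField, map_add, LinearMap.add_apply]
      exact map_add g _ _)
    (fun c g v => LinearMap.ext fun w => iterSucc_ext fun j => by
      rw [LinearMap.smul_apply, iterCoeff_smul]
      simp only [iterCoeff_compField, map_smul, LinearMap.smul_apply]
      exact map_smul g _ _)

/-- `(v₁, …, vₙ) ↦ (w ↦ Y(v₁,x₁) ⋯ Y(vₙ,xₙ) w)`. -/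
def fieldProduct (Y : V →ₗ[ℂ] VertexOperator ℂ V) :
    (n : ℕ) → MultilinearMap ℂ (fun _ : Fin n => V) (V →ₗ[ℂ] IterSeries V n)
  | 0 => MultilinearMap.constOfIsEmpty ℂ (fun _ : Fin 0 => V)
      { toFun := fun w => w, map_add' := fun _ _ => rfl, map_smul' := fun _ _ => rfl }
  | n + 1 => MultilinearMap.uncurryRight (M := fun _ : Fin (n + 1) => V)
      ((compFieldₗ Y).compMultilinearMap (fieldProduct Y n))

/-- The linear map `πₙ : V^{⊗n} ⊗ ℂ((x₁))⋯((xₙ)) → Hom(V, V((x₁))⋯((xₙ)))`,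
`πₙ(v₁ ⊗ ⋯ ⊗ vₙ ⊗ f)(w) = f(x₁,…,xₙ) Y(v₁,x₁) ⋯ Y(vₙ,xₙ) w`. -/
def piMap (Y : V →ₗ[ℂ] VertexOperator ℂ V) (n : ℕ) :
    (PiTensorProduct ℂ (fun _ : Fin n => V)) ⊗[ℂ] (IterField n) →ₗ[ℂ] (V →ₗ[ℂ] IterSeries V n) :=
  TensorProduct.lift
    ((Algebra.lsmul ℂ ℂ (V →ₗ[ℂ] IterSeries V n) :
        IterField n →ₐ[ℂ] Module.End ℂ (V →ₗ[ℂ] IterSeries V n)).toLinearMap.flip ∘ₗ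
      PiTensorProduct.lift (fieldProduct Y n))

theorem piMap_tprod (Y : V →ₗ[ℂ] VertexOperator ℂ V) (n : ℕ) (v : Fin n → V) (f : IterField n)
    (w : V) : piMap Y n (PiTensorProduct.tprod ℂ v ⊗ₜ f) w = f • fieldProduct Y n v w := by
  simp [piMap]

/-- Nondegeneracy in the sense of Etingof and Kazhdan: for every `n ≥ 1` the map
`Zₙ(v₁ ⊗ ⋯ ⊗ vₙ ⊗ f) = f(x₁,…,xₙ) Y(v₁,x₁) ⋯ Y(vₙ,xₙ) 𝟏` is injective on
`V^{⊗n} ⊗ ℂ((x₁))⋯((xₙ))`. -/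
def IsNondegenerate (Y : V →ₗ[ℂ] VertexOperator ℂ V) (vac : V) : Prop :=
  ∀ n : ℕ, 1 ≤ n → Function.Injective fun t => piMap Y n t vac

end IteratedLaurent

section Locality

variable {V : Type u} [AddCommGroup V] [Module ℂ V]

/-- The mode `vₙ`, the coefficient of `x^{-n-1}` in `Y(v,x)`. -/
def mode (Y : V →ₗ[ℂ] VertexOperator ℂ V) (v : V) (n : ℤ) : Module.End ℂ V :=
  VertexOperator.ncoeff (Y v) n

/-- The coefficient of `x₀^{-l-1} x₁^{-m-1} x₂^{-n-1}` in
`x₀⁻¹ δ((x₁ - x₂)/x₀) Y(u,x₁) Y(v,x₂) w`, where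
`x₀⁻¹ δ((x₁ - x₂)/x₀) = ∑ p ∈ ℤ, x₀^{-p-1} (x₁ - x₂)^p` and `(x₁ - x₂)^p` is expanded in
nonnegative powers of `x₂`. -/
def jacobiLeft (Y : V →ₗ[ℂ] VertexOperator ℂ V) (u v w : V) (l m n : ℤ) : V :=
  ∑ᶠ i : ℕ, ((-1) ^ i * Ring.choose l i : ℤ) • mode Y u (m + l - i) (mode Y v (n + i) w)

/-- The coefficient of `x₀^{-l-1} x₁^{-m-1} x₂^{-n-1}` in
`x₀⁻¹ δ((x₂ - x₁)/(-x₀)) f(-x₀) Y(v',x₂) Y(u',x₁) w`, where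
`x₀⁻¹ δ((x₂ - x₁)/(-x₀)) = ∑ p ∈ ℤ, (-1)^p x₀^{-p-1} (x₂ - x₁)^p` and `(x₂ - x₁)^p` is expanded
in nonnegative powers of `x₁`; the summation index is `(j, k)` with `p = l + j`, and only finitely
many terms are nonzero. For `l = 0` it is the coefficient of `x₁^{-m-1} x₂^{-n-1}` in
`f(x₂ - x₁) Y(v',x₂) Y(u',x₁) w`. -/
def jacobiRight (Y : V →ₗ[ℂ] VertexOperator ℂ V) (f : LaurentSeries ℂ) (v' u' w : V)
    (l m n : ℤ) : V :=
  ∑ᶠ p : ℤ × ℕ, (((-1 : ℂ) ^ l * f.coeff p.1) *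
      (((-1) ^ p.2 * Ring.choose (l + p.1) p.2 : ℤ) : ℂ)) •
    mode Y v' (n + l + p.1 - p.2) (mode Y u' (m + p.2) w)

/-- The coefficient of `x₀^{-l-1} x₁^{-m-1} x₂^{-n-1}` in
`x₂⁻¹ δ((x₁ - x₀)/x₂) Y(Y(u,x₀)v,x₂) w`. -/
def jacobiIterate (Y : V →ₗ[ℂ] VertexOperator ℂ V) (u v w : V) (l m n : ℤ) : V :=
  ∑ᶠ i : ℕ, Ring.choose m i • mode Y (mode Y u (l + i) v) (m + n - i) w

/-- The `S`-Jacobi identity for the pair `u, v` and the element `∑ᵢ v' i ⊗ u' i ⊗ f i` of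
`V ⊗ V ⊗ ℂ((x))`:
`x₀⁻¹ δ((x₁-x₂)/x₀) Y(u,x₁) Y(v,x₂) - x₀⁻¹ δ((x₂-x₁)/(-x₀)) ∑ᵢ fᵢ(-x₀) Y(v'ᵢ,x₂) Y(u'ᵢ,x₁)
  = x₂⁻¹ δ((x₁-x₀)/x₂) Y(Y(u,x₀)v,x₂)`, coefficient by coefficient. -/
def SJacobi (Y : V →ₗ[ℂ] VertexOperator ℂ V) (u v : V) {r : ℕ} (v' u' : Fin r → V)
    (f : Fin r → LaurentSeries ℂ) : Prop :=
  ∀ (w : V) (l m n : ℤ),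
    jacobiLeft Y u v w l m n - ∑ i, jacobiRight Y (f i) (v' i) (u' i) w l m n
      = jacobiIterate Y u v w l m n

/-- Multiplication of a formal series by `(x₁ - x₂)^k`, where `F m n` is the coefficient of
`x₁^{-m-1} x₂^{-n-1}`. -/
def mulSubPow (k : ℕ) (F : ℤ → ℤ → V) (m n : ℤ) : V :=
  ∑ i ∈ Finset.range (k + 1), ((-1) ^ i * (k.choose i) : ℤ) • F (m + k - i) (n + i)

/-- `S`-locality for the pair `u, v` and the element `∑ᵢ v' i ⊗ u' i ⊗ f i` of
`V ⊗ V ⊗ ℂ((x))`: for some `k`,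
`(x₁-x₂)^k Y(u,x₁) Y(v,x₂) = (x₁-x₂)^k ∑ᵢ fᵢ(x₂-x₁) Y(v'ᵢ,x₂) Y(u'ᵢ,x₁)`. -/
def SLocal (Y : V →ₗ[ℂ] VertexOperator ℂ V) (u v : V) {r : ℕ} (v' u' : Fin r → V)
    (f : Fin r → LaurentSeries ℂ) : Prop :=
  ∃ k : ℕ, ∀ (w : V) (m n : ℤ),
    mulSubPow k (fun a b => mode Y u a (mode Y v b w)) m n
      = mulSubPow k (fun a b => ∑ i, jacobiRight Y (f i) (v' i) (u' i) w 0 a b) m n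

end Locality

section YangBaxter

/-- The substitution `f(x) ↦ f(-x)` on `ℂ((x))`. -/
def substNeg : LaurentSeries ℂ →ₗ[ℂ] LaurentSeries ℂ where
  toFun f := HahnSeries.mk (fun n => (-1 : ℂ) ^ n * f.coeff n)
    (f.isPWO_support.mono fun n hn => right_ne_zero_of_mul hn)
  map_add' f g := by ext n; simp [mul_add]
  map_smul' c f := by ext n; simp [mul_left_comm]

/-- The substitution `f(x) ↦ f(x) ∈ ℂ((x))((z))`. -/
def substX : LaurentSeries ℂ →ₗ[ℂ] LaurentSeries (LaurentSeries ℂ) where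
  toFun f := HahnSeries.single 0 f
  map_add' f g := HahnSeries.single_add 0 f g
  map_smul' c f := by
    refine HahnSeries.ext (funext fun n => ?_)
    rw [HahnSeries.coeff_smul, HahnSeries.coeff_single, HahnSeries.coeff_single]
    split_ifs <;> simp

/-- The substitution `f(x) ↦ f(z) ∈ ℂ((x))((z))`. -/
def substZ : LaurentSeries ℂ →ₗ[ℂ] LaurentSeries (LaurentSeries ℂ) where
  toFun f := f.map (HahnSeries.C : ℂ →+* LaurentSeries ℂ)
  map_add' f g := HahnSeries.ext (funext fun n =>
    map_add (HahnSeries.C : ℂ →+* LaurentSeries ℂ) (f.coeff n) (g.coeff n))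
  map_smul' c f := HahnSeries.ext (funext fun n =>
    (map_mul (HahnSeries.C : ℂ →+* LaurentSeries ℂ) c (f.coeff n)).trans HahnSeries.C_mul_eq_smul)

/-- The substitution `f(x) ↦ f(x + z) ∈ ℂ((x))((z))`, expanded in nonnegative powers of `z`:
`f(x + z) = ∑ k ≥ 0, (f^{(k)}(x) / k!) z^k`. -/
def substXAddZ : LaurentSeries ℂ →ₗ[ℂ] LaurentSeries (LaurentSeries ℂ) where
  toFun f := HahnSeries.ofPowerSeries ℤ (LaurentSeries ℂ)
    (PowerSeries.mk fun k => LaurentSeries.hasseDeriv ℂ k f)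
  map_add' f g := by
    rw [← map_add]
    congr 1
    refine PowerSeries.ext fun k => ?_
    simp only [PowerSeries.coeff_mk, map_add]
  map_smul' c f := by
    have h : (PowerSeries.mk fun k => LaurentSeries.hasseDeriv ℂ k (c • f))
        = PowerSeries.C (HahnSeries.C c : LaurentSeries ℂ) *
          PowerSeries.mk fun k => LaurentSeries.hasseDeriv ℂ k f := by
      refine PowerSeries.ext fun k => ?_
      rw [PowerSeries.coeff_C_mul, PowerSeries.coeff_mk, PowerSeries.coeff_mk, map_smul]
      exact HahnSeries.C_mul_eq_smul.symm
    rw [h, map_mul, HahnSeries.ofPowerSeries_C, HahnSeries.C_mul_eq_smul]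
    refine HahnSeries.ext (funext fun n => ?_)
    exact HahnSeries.C_mul_eq_smul

/-- For `T(x) : U → U ⊗ ℂ((x))` and a substitution `φ : ℂ((x)) → A`, the `A`-linear extension
`U ⊗ A → U ⊗ A`, `t ⊗ a ↦ T(φ(x))(t) a`. -/
def extend {U : Type u} [AddCommGroup U] [Module ℂ U] (A : Type) [CommRing A] [Algebra ℂ A]
    (φ : LaurentSeries ℂ →ₗ[ℂ] A) (T : U →ₗ[ℂ] U ⊗[ℂ] LaurentSeries ℂ) :
    U ⊗[ℂ] A →ₗ[ℂ] U ⊗[ℂ] A :=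
  (LinearMap.mul' ℂ A).lTensor U ∘ₗ (TensorProduct.assoc ℂ U A A).toLinearMap ∘ₗ
    (φ.lTensor U ∘ₗ T).rTensor A

variable {V : Type u} [AddCommGroup V] [Module ℂ V]

/-- `S₂₁(x) = σ S(x) σ` with `σ` the flip of `V ⊗ V`. -/
def S21 (S : V ⊗[ℂ] V →ₗ[ℂ] (V ⊗[ℂ] V) ⊗[ℂ] LaurentSeries ℂ) :
    V ⊗[ℂ] V →ₗ[ℂ] (V ⊗[ℂ] V) ⊗[ℂ] LaurentSeries ℂ :=
  (TensorProduct.comm ℂ V V).toLinearMap.rTensor _ ∘ₗ S ∘ₗ (TensorProduct.comm ℂ V V).toLinearMap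

/-- `S₁₂(x)` on `V ⊗ V ⊗ V`. -/
def S12 (S : V ⊗[ℂ] V →ₗ[ℂ] (V ⊗[ℂ] V) ⊗[ℂ] LaurentSeries ℂ) :
    (V ⊗[ℂ] V) ⊗[ℂ] V →ₗ[ℂ] ((V ⊗[ℂ] V) ⊗[ℂ] V) ⊗[ℂ] LaurentSeries ℂ :=
  (TensorProduct.rightComm ℂ (V ⊗[ℂ] V) (LaurentSeries ℂ) V).toLinearMap ∘ₗ S.rTensor V

/-- `S₂₃(x)` on `V ⊗ V ⊗ V`. -/
def S23 (S : V ⊗[ℂ] V →ₗ[ℂ] (V ⊗[ℂ] V) ⊗[ℂ] LaurentSeries ℂ) :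
    (V ⊗[ℂ] V) ⊗[ℂ] V →ₗ[ℂ] ((V ⊗[ℂ] V) ⊗[ℂ] V) ⊗[ℂ] LaurentSeries ℂ :=
  (TensorProduct.assoc ℂ V V V).symm.toLinearMap.rTensor _ ∘ₗ
    (TensorProduct.assoc ℂ V (V ⊗[ℂ] V) (LaurentSeries ℂ)).symm.toLinearMap ∘ₗ
    S.lTensor V ∘ₗ (TensorProduct.assoc ℂ V V V).toLinearMap

/-- `S₁₃(x) = P₂₃ S₁₂(x) P₂₃` on `V ⊗ V ⊗ V`, with `P₂₃(a ⊗ b ⊗ c) = a ⊗ c ⊗ b`. -/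
def S13 (S : V ⊗[ℂ] V →ₗ[ℂ] (V ⊗[ℂ] V) ⊗[ℂ] LaurentSeries ℂ) :
    (V ⊗[ℂ] V) ⊗[ℂ] V →ₗ[ℂ] ((V ⊗[ℂ] V) ⊗[ℂ] V) ⊗[ℂ] LaurentSeries ℂ :=
  (TensorProduct.rightComm ℂ V V V).toLinearMap.rTensor _ ∘ₗ S12 S ∘ₗ
    (TensorProduct.rightComm ℂ V V V).toLinearMap

/-- A unitary rational quantum Yang–Baxter operator `S(x) : V ⊗ V → V ⊗ V ⊗ ℂ((x))`. -/
structure IsUnitaryRationalYB (S : V ⊗[ℂ] V →ₗ[ℂ] (V ⊗[ℂ] V) ⊗[ℂ] LaurentSeries ℂ) : Prop where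
  /-- `S₂₁(x) S(-x) = 1`. -/
  unitary : extend (LaurentSeries ℂ) LinearMap.id (S21 S) ∘ₗ
    extend (LaurentSeries ℂ) substNeg S = LinearMap.id
  /-- `S₁₂(x) S₁₃(x+z) S₂₃(z) = S₂₃(z) S₁₃(x+z) S₁₂(x)`. -/
  yang_baxter :
    extend (LaurentSeries (LaurentSeries ℂ)) substX (S12 S) ∘ₗ
        extend (LaurentSeries (LaurentSeries ℂ)) substXAddZ (S13 S) ∘ₗ
        extend (LaurentSeries (LaurentSeries ℂ)) substZ (S23 S)
      = extend (LaurentSeries (LaurentSeries ℂ)) substZ (S23 S) ∘ₗ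
        extend (LaurentSeries (LaurentSeries ℂ)) substXAddZ (S13 S) ∘ₗ
        extend (LaurentSeries (LaurentSeries ℂ)) substX (S12 S)

end YangBaxter

section QuantumVertexAlgebra

/-- A weak quantum vertex algebra structure on the complex vector space `V`. -/
structure WeakQuantumVertexAlgebra (V : Type u) [AddCommGroup V] [Module ℂ V] where
  /-- The vertex operator map `v ↦ Y(v,x) ∈ Hom(V, V((x)))`. -/
  Y : V →ₗ[ℂ] VertexOperator ℂ V
  /-- The vacuum vector `𝟏`. -/
  vac : V
  /-- `Y(𝟏,x) w = w`. -/
  vacuum : ∀ w : V, Y vac w = HahnModule.of ℂ (HahnSeries.single 0 w)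
  /-- `Y(v,x)𝟏 ∈ V[[x]]`. -/
  creation_regular : ∀ (v : V) (j : ℤ), j < 0 → HVertexOperator.coeff (Y v) j vac = 0
  /-- The constant term of `Y(v,x)𝟏` is `v`. -/
  creation : ∀ v : V, HVertexOperator.coeff (Y v) 0 vac = v
  /-- For all `u, v` the `S`-Jacobi identity holds for some element of `V ⊗ V ⊗ ℂ((x))`. -/
  jacobi : ∀ u v : V, ∃ (r : ℕ) (v' u' : Fin r → V) (f : Fin r → LaurentSeries ℂ),
    SJacobi Y u v v' u' f

variable {V : Type u} [AddCommGroup V] [Module ℂ V]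

/-- The weak quantum vertex algebra `𝒱` equipped with `S(x)` is a quantum vertex algebra: `S(x)`
is a unitary rational quantum Yang–Baxter operator and for all `u, v` the `S`-Jacobi identity holds
with `∑ᵢ v'ᵢ ⊗ u'ᵢ ⊗ fᵢ(x) = S(x)(v ⊗ u)`. -/
structure IsQuantumVertexAlgebra (𝒱 : WeakQuantumVertexAlgebra V)
    (S : V ⊗[ℂ] V →ₗ[ℂ] (V ⊗[ℂ] V) ⊗[ℂ] LaurentSeries ℂ) : Prop where
  yangBaxter : IsUnitaryRationalYB S
  jacobi : ∀ u v : V, ∃ (r : ℕ) (v' u' : Fin r → V) (f : Fin r → LaurentSeries ℂ),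
    S (v ⊗ₜ u) = ∑ i, (v' i ⊗ₜ u' i) ⊗ₜ f i ∧ SJacobi 𝒱.Y u v v' u' f

end QuantumVertexAlgebra

end QVA

end

open scoped TensorProduct

noncomputable section

namespace QVA

universe u

section

/-! Products of fields in different orders live in different spaces of iterated Laurent series. They
all lie in `lowFinite`, though, where multiplication by ℂ[[x₀,x₁,x₂]] is a finite sum at each
exponent. So the products of three fields, in all six orders, become power-series-linear maps `corr
Y σ w` into a single module. Injectivity of π₃ then says that an element of V^{⊗3} ⊗ ℂ[[x₀,x₁,x₂]]
killed by `corr Y 1 w` for every `w` is zero (`eq_zero_of_corr_eq_zero`).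

The Jacobi identity implies locality, because the iterate has no coefficients of x₀^{-l-1} with l
large (`SJacobi.sLocal`). A power of x₁ - x₂ that also clears the poles of the fᵢ turns locality
into an identity with power series coefficients, valid for either neighbouring pair among three
fields (`SLocal.isLocal`). With a fixed nonzero vector in the third slot, injectivity shows that v ⊗
u determines the exchanged element (`IsLocal.unique`); hence these elements assemble into one linear
map S.

Unitarity and the Yang–Baxter equation express coherence of reordering. Each exchange of neighbours
acts by S up to a power series factor (`Transports`), and two chains of exchanges ending in the
identity order act equally once the factors become invertible (`Transports.eq`). Exchanging twice
against not at all gives unitarity; the two ways of reversing three fields give Yang–Baxter, with x₀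
- x₁, x₁ - x₂, x₀ - x₂ sent to x, z, x + z.

The Jacobi identity for S is the given one, since locality identifies its element with S(v ⊗ u).
Nondegeneracy implies injectivity of π₃, so the second part reduces to the first. -/

theorem exists_ne_zero_of_finsum_ne_zero {α M : Type*} [AddCommMonoid M] {f : α → M}
    (h : ∑ᶠ a, f a ≠ 0) : ∃ a, f a ≠ 0 := by
  contrapose! h
  exact finsum_eq_zero_of_forall_eq_zero h

/-! ### Formal distributions as a module over power series -/

section Exponents

variable {ι : Type}

/-- The exponent `p - a`. -/
def expSub (p : ι → ℤ) (a : ι →₀ ℕ) : ι → ℤ := fun i => p i - a i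

theorem expSub_add (p : ι → ℤ) (a b : ι →₀ ℕ) : expSub p (a + b) = expSub (expSub p a) b := by
  funext i
  simp [expSub]
  ring

theorem expSub_zero (p : ι → ℤ) : expSub p 0 = p := by
  funext i
  simp [expSub]

theorem expSub_injective (p : ι → ℤ) : Function.Injective (expSub p) := fun a b h => by
  ext i
  have := congrFun h i
  simp only [expSub] at this
  omega

theorem expSub_le (p : ι → ℤ) (a : ι →₀ ℕ) : expSub p a ≤ p := fun i => by
  simp [expSub]

variable {V : Type u} [AddCommGroup V] [Module ℂ V]

/-- The product of a formal power series and a formal distribution. -/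
def conv (F : MvPowerSeries ι ℂ) (s : (ι → ℤ) → V) (p : ι → ℤ) : V :=
  ∑ᶠ a : ι →₀ ℕ, MvPowerSeries.coeff a F • s (expSub p a)

theorem conv_eq_sum (F : MvPowerSeries ι ℂ) {s : (ι → ℤ) → V} {p : ι → ℤ} {B : Finset (ι →₀ ℕ)}
    (hB : ∀ a, s (expSub p a) ≠ 0 → a ∈ B) :
    conv F s p = ∑ a ∈ B, MvPowerSeries.coeff a F • s (expSub p a) :=
  finsum_eq_sum_of_support_subset _ fun a ha => hB a (right_ne_zero_of_smul ha)

end Exponents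

section LowFinite

variable (ι : Type) (V : Type u) [AddCommGroup V] [Module ℂ V]

/-- The families `(s p)`, `p ∈ ℤ^ι`, with only finitely many nonzero members below any given
exponent. Every iterated Laurent series, in any order of the variables, is of this kind. -/
def lowFinite : Submodule ℂ ((ι → ℤ) → V) where
  carrier := {s | ∀ m : ι → ℤ, {p | p ≤ m ∧ s p ≠ 0}.Finite}
  zero_mem' := fun m => by simp
  add_mem' := fun {s t} hs ht m => ((hs m).union (ht m)).subset fun p hp => by
    by_contra h
    simp only [Set.mem_union, Set.mem_ofPred_eq, not_or, not_and, not_not] at h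
    exact hp.2 (by rw [Pi.add_apply, h.1 hp.1, h.2 hp.1, add_zero])
  smul_mem' := fun c s hs m => (hs m).subset fun p hp =>
    ⟨hp.1, fun h => hp.2 (by rw [Pi.smul_apply, h, smul_zero])⟩

variable {ι V}

theorem finite_expSub {s : (ι → ℤ) → V} (hs : s ∈ lowFinite ι V) (p : ι → ℤ) :
    {a | s (expSub p a) ≠ 0}.Finite :=
  ((hs p).preimage (expSub_injective p).injOn).subset fun a ha => ⟨expSub_le p a, ha⟩

/-- Downward closure makes `B × B` contain every splitting of an exponent of `B`, so one finite set
serves the Cauchy product and both of its factors. -/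
theorem exists_lower_finset {s : (ι → ℤ) → V} (hs : s ∈ lowFinite ι V) (p : ι → ℤ) :
    ∃ B : Finset (ι →₀ ℕ), (∀ a, s (expSub p a) ≠ 0 → a ∈ B) ∧ ∀ a ∈ B, ∀ b ≤ a, b ∈ B := by
  classical
  refine ⟨(finite_expSub hs p).toFinset.biUnion fun a => Finset.Icc 0 a, fun a ha => ?_,
    fun a ha b hb => ?_⟩
  · exact Finset.mem_biUnion.2 ⟨a, by simpa using ha, by simp⟩
  · obtain ⟨c, hc, hac⟩ := Finset.mem_biUnion.1 ha
    exact Finset.mem_biUnion.2 ⟨c, hc, by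
      rw [Finset.mem_Icc] at hac ⊢
      exact ⟨zero_le, hb.trans hac.2⟩⟩

/-- Associativity can fail for products of formal distributions; low finiteness turns it into an
interchange of finite sums. -/
theorem conv_mul (F G : MvPowerSeries ι ℂ) {s : (ι → ℤ) → V} (hs : s ∈ lowFinite ι V) :
    conv (F * G) s = conv F (conv G s) := by
  classical
  funext p
  obtain ⟨B, hB, hlow⟩ := exists_lower_finset hs p
  have h1 : ∀ b, conv G s (expSub p b)
      = ∑ c ∈ B, MvPowerSeries.coeff c G • s (expSub p (b + c)) := fun b => by
    simp only [expSub_add]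
    refine conv_eq_sum G fun c hc => ?_
    rw [← expSub_add] at hc
    exact hlow _ (hB _ hc) _ (le_add_of_nonneg_left (zero_le))
  rw [conv_eq_sum _ hB, conv_eq_sum (B := B)]
  · simp only [h1, MvPowerSeries.coeff_mul, Finset.sum_smul, Finset.smul_sum, smul_smul]
    rw [Finset.sum_sigma', ← Finset.sum_product']
    -- The triple (a, b, c) with b + c = a corresponds to (b, c). Pairs in `B × B` with b + c
    -- outside `B` contribute zero, so only nonzero terms are matched.
    refine Finset.sum_bij_ne_zero (fun x _ _ => x.2) (fun x hx _ => ?_) (fun x hx _ y hy _ h => ?_)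
      (fun x hx h => ?_) (fun x hx _ => ?_)
    · rw [Finset.mem_sigma, Finset.HasAntidiagonal.mem_antidiagonal] at hx
      rw [Finset.mem_product]
      exact ⟨hlow _ hx.1 _ (hx.2 ▸ le_add_of_nonneg_right (zero_le)),
        hlow _ hx.1 _ (hx.2 ▸ le_add_of_nonneg_left (zero_le))⟩
    · rw [Finset.mem_sigma, Finset.HasAntidiagonal.mem_antidiagonal] at hx hy
      obtain ⟨a, b⟩ := x
      obtain ⟨c, d⟩ := y
      obtain rfl : b = d := h
      obtain rfl : a = c := hx.2.symm.trans hy.2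
      rfl
    · exact ⟨⟨x.1 + x.2, x⟩, Finset.mem_sigma.2 ⟨hB _ (right_ne_zero_of_smul h),
        Finset.HasAntidiagonal.mem_antidiagonal.2 rfl⟩, h, rfl⟩
    · rw [Finset.mem_sigma, Finset.HasAntidiagonal.mem_antidiagonal] at hx
      rw [hx.2]
  · intro b hb
    rw [h1] at hb
    obtain ⟨c, _, hc⟩ := Finset.exists_ne_zero_of_sum_ne_zero hb
    exact hlow _ (hB _ (right_ne_zero_of_smul hc)) _ (le_add_of_nonneg_right (zero_le))

variable [Fintype ι]

/-- A nonzero value at `p ≤ m` comes from some `q ≤ p` in the support of `s`. Finitely many such `q`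
lie below `m`, and each box `[q, m]` is finite. -/
theorem conv_mem (F : MvPowerSeries ι ℂ) {s : (ι → ℤ) → V} (hs : s ∈ lowFinite ι V) :
    conv F s ∈ lowFinite ι V := fun m => by
  classical
  refine (((hs m).toFinset.finite_toSet.biUnion fun q _ => Set.finite_Icc q m)).subset
    fun p hp => ?_
  obtain ⟨a, ha⟩ := exists_ne_zero_of_finsum_ne_zero hp.2
  refine Set.mem_biUnion (x := expSub p a) ?_ ⟨expSub_le p a, hp.1⟩
  simpa using ⟨(expSub_le p a).trans hp.1, right_ne_zero_of_smul ha⟩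

instance : SMul (MvPowerSeries ι ℂ) (lowFinite ι V) := ⟨fun F s => ⟨conv F s, conv_mem F s.2⟩⟩

theorem smul_apply (F : MvPowerSeries ι ℂ) (s : lowFinite ι V) (p : ι → ℤ) :
    (F • s : lowFinite ι V).1 p = ∑ᶠ a : ι →₀ ℕ, MvPowerSeries.coeff a F • s.1 (expSub p a) := rfl

instance : Module (MvPowerSeries ι ℂ) (lowFinite ι V) where
  one_smul s := Subtype.ext <| funext fun p => by
    classical
    rw [smul_apply, finsum_eq_single _ 0 fun a ha => ?_]
    · rw [expSub_zero, MvPowerSeries.coeff_zero_one, one_smul]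
    · rw [MvPowerSeries.coeff_one, if_neg ha, zero_smul]
  mul_smul F G s := Subtype.ext (conv_mul F G s.2)
  smul_zero F := Subtype.ext <| funext fun p => by
    rw [smul_apply]
    simp
  zero_smul s := Subtype.ext <| funext fun p => by
    rw [smul_apply]
    simp
  add_smul F G s := Subtype.ext <| funext fun p => by
    obtain ⟨B, hB, -⟩ := exists_lower_finset s.2 p
    change conv (F + G) s.1 p = conv F s.1 p + conv G s.1 p
    simp only [conv_eq_sum _ hB, map_add, add_smul, Finset.sum_add_distrib]
  smul_add F s t := Subtype.ext <| funext fun p => by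
    classical
    obtain ⟨B, hB, -⟩ := exists_lower_finset s.2 p
    obtain ⟨B', hB', -⟩ := exists_lower_finset t.2 p
    change conv F (s.1 + t.1) p = conv F s.1 p + conv F t.1 p
    rw [conv_eq_sum (B := B ∪ B'), conv_eq_sum (B := B ∪ B') F (s := s.1),
      conv_eq_sum (B := B ∪ B') F (s := t.1), ← Finset.sum_add_distrib]
    · simp only [Pi.add_apply, smul_add]
    · exact fun a ha => Finset.mem_union_right _ (hB' a ha)
    · exact fun a ha => Finset.mem_union_left _ (hB a ha)
    · intro a ha
      by_contra h
      rw [Finset.mem_union, not_or] at h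
      exact ha (by rw [Pi.add_apply, not_imp_comm.1 (hB a) h.1, not_imp_comm.1 (hB' a) h.2,
        add_zero])

instance : IsScalarTower ℂ (MvPowerSeries ι ℂ) (lowFinite ι V) where
  smul_assoc c F s := Subtype.ext <| funext fun p => by
    obtain ⟨B, hB, -⟩ := exists_lower_finset s.2 p
    change conv (c • F) s.1 p = c • conv F s.1 p
    simp only [conv_eq_sum _ hB, Finset.smul_sum, map_smul, smul_assoc]

/-- Permutation of the variables. -/
def reindex (σ : Equiv.Perm ι) : lowFinite ι V →ₗ[ℂ] lowFinite ι V where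
  toFun s := ⟨fun p => s.1 (p ∘ σ), fun m =>
    ((s.2 (m ∘ σ)).preimage
      (fun _ _ _ _ h => σ.surjective.injective_comp_right h : Set.InjOn (· ∘ σ) _)).subset
      fun _ hp => ⟨fun i => hp.1 (σ i), hp.2⟩⟩
  map_add' _ _ := rfl
  map_smul' _ _ := rfl

end LowFinite

/-! ### Power series in a linear form of two variables -/

section LinearSubstitution

variable {ι : Type}

theorem hasSubst_linear (c d : ℂ) (i j : ι) :
    PowerSeries.HasSubst (c • MvPowerSeries.X i + d • MvPowerSeries.X j : MvPowerSeries ι ℂ) :=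
  .of_constantCoeff_zero (by simp)

theorem coeff_linear_pow [DecidableEq ι] (c d : ℂ) (i j : ι) (n : ℕ) (e : ι →₀ ℕ) :
    MvPowerSeries.coeff e ((c • MvPowerSeries.X i + d • MvPowerSeries.X j : MvPowerSeries ι ℂ) ^ n)
      = ∑ m ∈ Finset.range (n + 1), if e = Finsupp.single i m + Finsupp.single j (n - m) then
        c ^ m * d ^ (n - m) * n.choose m else 0 := by
  rw [add_pow, map_sum]
  refine Finset.sum_congr rfl fun m _ => ?_
  rw [smul_pow, smul_pow, MvPowerSeries.X_pow_eq, MvPowerSeries.X_pow_eq, smul_mul_smul_comm,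
    MvPowerSeries.monomial_mul_monomial, ← nsmul_eq_mul', map_nsmul, map_smul,
    MvPowerSeries.coeff_monomial]
  split_ifs <;> simp [mul_comm]

theorem coeff_subst_linear (c d : ℂ) {i j : ι} (hij : i ≠ j) (f : PowerSeries ℂ) (a b : ℕ) :
    MvPowerSeries.coeff (Finsupp.single i a + Finsupp.single j b)
      (f.subst (c • MvPowerSeries.X i + d • MvPowerSeries.X j : MvPowerSeries ι ℂ))
      = f.coeff (a + b) * (c ^ a * d ^ b * (a + b).choose a) := by
  classical
  -- By homogeneity only the power of degree a + b contributes.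
  rw [PowerSeries.coeff_subst (hasSubst_linear c d i j), finsum_eq_single _ (a + b)]
  · rw [coeff_linear_pow, Finset.sum_eq_single a]
    · simp
    · intro m _ hm
      rw [if_neg]
      intro h
      have := DFunLike.congr_fun h i
      simp [hij] at this
      exact hm this.symm
    · intro h
      simp at h
  · intro n hn
    rw [coeff_linear_pow, Finset.sum_eq_zero, smul_zero]
    intro m hm
    rw [if_neg]
    intro h
    have h1 := DFunLike.congr_fun h i
    have h2 := DFunLike.congr_fun h j
    simp [hij, hij.symm] at h1 h2
    rw [Finset.mem_range] at hm
    omega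

theorem exists_of_coeff_subst_linear_ne_zero (c d : ℂ) (i j : ι) (f : PowerSeries ℂ) (e : ι →₀ ℕ)
    (h : MvPowerSeries.coeff e
      (f.subst (c • MvPowerSeries.X i + d • MvPowerSeries.X j : MvPowerSeries ι ℂ)) ≠ 0) :
    ∃ a b, e = Finsupp.single i a + Finsupp.single j b := by
  classical
  rw [PowerSeries.coeff_subst (hasSubst_linear c d i j)] at h
  obtain ⟨n, hn⟩ := exists_ne_zero_of_finsum_ne_zero h
  have := right_ne_zero_of_smul hn
  rw [coeff_linear_pow] at this
  obtain ⟨m, _, hm⟩ := Finset.exists_ne_zero_of_sum_ne_zero this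
  exact ⟨m, n - m, by_contra fun h => hm (if_neg h)⟩

theorem finsum_eq_finsum_comp {α β M : Type*} [AddCommMonoid M] {g : α → β}
    (hg : Function.Injective g) {f : β → M} (hf : ∀ b, f b ≠ 0 → b ∈ Set.range g) :
    ∑ᶠ b, f b = ∑ᶠ a, f (g a) := by
  rw [← finsum_mem_range hg, ← finsum_mem_univ]
  refine finsum_mem_inter_support_eq' _ _ _ fun b hb => ?_
  exact ⟨fun _ => hf b hb, fun _ => trivial⟩

theorem subst_linear_smul_apply {V : Type u} [AddCommGroup V] [Module ℂ V] [Fintype ι]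
    (c d : ℂ) {i j : ι}
    (hij : i ≠ j) (f : PowerSeries ℂ) (s : lowFinite ι V) (p : ι → ℤ) :
    (f.subst (c • MvPowerSeries.X i + d • MvPowerSeries.X j : MvPowerSeries ι ℂ) • s).1 p
      = ∑ᶠ x : ℕ × ℕ, (f.coeff (x.1 + x.2) * (c ^ x.1 * d ^ x.2 * (x.1 + x.2).choose x.1)) •
        s.1 (expSub p (Finsupp.single i x.1 + Finsupp.single j x.2)) := by
  rw [smul_apply, finsum_eq_finsum_comp
    (g := fun x : ℕ × ℕ => Finsupp.single i x.1 + Finsupp.single j x.2)]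
  · simp only [coeff_subst_linear c d hij]
  · rintro ⟨a, b⟩ ⟨a', b'⟩ h
    have h1 := DFunLike.congr_fun h i
    have h2 := DFunLike.congr_fun h j
    simp [hij, hij.symm] at h1 h2
    rw [h1, h2]
  · intro e he
    obtain ⟨a, b, rfl⟩ := exists_of_coeff_subst_linear_ne_zero c d i j f e (left_ne_zero_of_smul he)
    exact ⟨(a, b), rfl⟩

end LinearSubstitution

end

/-! ### Coefficients of iterated Laurent series -/

section

theorem ofPowerSeries_coeff_int {R : Type*} [CommRing R] (g : PowerSeries R) (j : ℤ) :
    (HahnSeries.ofPowerSeries ℤ R g).coeff j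
      = if 0 ≤ j then PowerSeries.coeff j.toNat g else 0 := by
  have := PowerSeries.coeff_coe g j
  rw [this]
  split_ifs with h1 h2 h2
  · omega
  · rfl
  · rw [show j.natAbs = j.toNat by omega]
  · omega

section IteratedCoefficients

variable {V : Type u} [AddCommGroup V] [Module ℂ V]

/-- The coefficient of `xₙ₊₁ ^ j` as a linear map. -/
def iterCoeffₗ (n : ℕ) (j : ℤ) : IterSeries V (n + 1) →ₗ[ℂ] IterSeries V n where
  toFun s := iterCoeff s j
  map_add' s t := iterCoeff_add s t j
  map_smul' c s := iterCoeff_smul c s j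

/-- All coefficients of an iterated Laurent series. -/
def coeffs : (n : ℕ) → IterSeries V n →ₗ[ℂ] ((Fin n → ℤ) → V)
  | 0 => { toFun := fun s _ => s, map_add' := fun _ _ => rfl, map_smul' := fun _ _ => rfl }
  | n + 1 => LinearMap.pi fun p =>
      LinearMap.proj (Fin.init p : Fin n → ℤ) ∘ₗ coeffs n ∘ₗ iterCoeffₗ n (p (Fin.last n))

theorem coeffs_succ (n : ℕ) (s : IterSeries V (n + 1)) (p : Fin (n + 1) → ℤ) :
    coeffs (n + 1) s p = coeffs n (iterCoeff s (p (Fin.last n))) (Fin.init p) := rfl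

theorem coeffs_injective : (n : ℕ) → Function.Injective (coeffs (V := V) n)
  | 0 => fun _ _ h => congrFun h Fin.elim0
  | n + 1 => fun s t h => iterSucc_ext fun j => coeffs_injective n <| funext fun q => by
      simpa [coeffs_succ] using congrFun h (Fin.snoc q j)

theorem exists_iterCoeff_eq_zero {n : ℕ} (s : IterSeries V (n + 1)) :
    ∃ N : ℤ, ∀ j < N, iterCoeff s j = 0 :=
  ⟨_, fun _ hj => HahnSeries.coeff_eq_zero_of_lt_order hj⟩

/-- The outermost exponent is bounded below by the order of the series and above by `m`; for each of
its finitely many values the inner coefficients are handled by induction. -/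
theorem coeffs_mem : (n : ℕ) → (s : IterSeries V n) → coeffs n s ∈ lowFinite (Fin n) V
  | 0 => fun s m => Set.toFinite _
  | n + 1 => fun s m => by
      obtain ⟨N, hN⟩ := exists_iterCoeff_eq_zero s
      refine ((Set.finite_Icc N (m (Fin.last n))).biUnion fun j _ =>
        (coeffs_mem n (iterCoeff s j) (Fin.init m)).image
          fun q => (Fin.snoc q j : Fin (n + 1) → ℤ)).subset fun p hp => ?_
      refine Set.mem_biUnion (x := p (Fin.last n)) ⟨?_, hp.1 _⟩
        ⟨Fin.init p, ⟨fun i => hp.1 _, hp.2⟩, Fin.snoc_init_self p⟩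
      by_contra h
      exact hp.2 (by rw [coeffs_succ, hN _ (not_le.1 h), map_zero]; rfl)

/-- The exponent `(a, b)`. -/
def expSnoc {n : ℕ} (b : ℕ) (a : Fin n →₀ ℕ) : Fin (n + 1) →₀ ℕ :=
  Finsupp.equivFunOnFinite.symm (Fin.snoc a b)

theorem expSnoc_bijective (n : ℕ) :
    Function.Bijective fun x : ℕ × (Fin n →₀ ℕ) => expSnoc x.1 x.2 := by
  constructor
  · rintro ⟨b, a⟩ ⟨b', a'⟩ h
    have h' : (Fin.snoc a b : Fin (n + 1) → ℕ) = Fin.snoc a' b' :=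
      Finsupp.equivFunOnFinite.symm.injective h
    obtain ⟨h1, h2⟩ := Fin.snoc_injective2 h'
    rw [h2, DFunLike.coe_injective h1]
  · intro e
    refine ⟨⟨e (Fin.last n), Finsupp.equivFunOnFinite.symm (Fin.init e)⟩, ?_⟩
    ext i
    change (Fin.snoc (Fin.init e) (e (Fin.last n)) : Fin (n + 1) → ℕ) i = e i
    rw [Fin.snoc_init_self]

theorem init_expSub_expSnoc {n : ℕ} (p : Fin (n + 1) → ℤ) (b : ℕ) (a : Fin n →₀ ℕ) :
    Fin.init (expSub p (expSnoc b a)) = expSub (Fin.init p) a := by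
  funext i
  simp [expSub, Fin.init, expSnoc]

theorem expSub_expSnoc_last {n : ℕ} (p : Fin (n + 1) → ℤ) (b : ℕ) (a : Fin n →₀ ℕ) :
    expSub p (expSnoc b a) (Fin.last n) = p (Fin.last n) - b := by
  simp [expSub, expSnoc]

/-- The coefficient of `xₙ₊₁ ^ b` in a formal power series in `x₁, …, xₙ₊₁`. -/
def slice {n : ℕ} (b : ℕ) : MvPowerSeries (Fin (n + 1)) ℂ →ₗ[ℂ] MvPowerSeries (Fin n) ℂ where
  toFun F := fun a => MvPowerSeries.coeff (expSnoc b a) F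
  map_add' _ _ := rfl
  map_smul' _ _ := rfl

theorem coeff_slice {n : ℕ} (b : ℕ) (F : MvPowerSeries (Fin (n + 1)) ℂ) (a : Fin n →₀ ℕ) :
    MvPowerSeries.coeff a (slice b F) = MvPowerSeries.coeff (expSnoc b a) F := rfl

theorem slice_ext {n : ℕ} {F G : MvPowerSeries (Fin (n + 1)) ℂ} (h : ∀ b, slice b F = slice b G) :
    F = G := by
  ext e
  obtain ⟨⟨b, a⟩, rfl⟩ := (expSnoc_bijective n).2 e
  exact congrArg (MvPowerSeries.coeff a) (h b)

/-- The inclusion of `ℂ[[x₁, …, xₙ]]` in `ℂ((x₁))⋯((xₙ))`. -/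
def toIterField : (n : ℕ) → MvPowerSeries (Fin n) ℂ →ₗ[ℂ] IterField n
  | 0 => (MvPowerSeries.coeff 0 : MvPowerSeries (Fin 0) ℂ →ₗ[ℂ] ℂ)
  | n + 1 =>
    { toFun := fun F => HahnSeries.ofPowerSeries ℤ (IterField n)
        (PowerSeries.mk fun b => toIterField n (slice b F))
      map_add' := fun F G => by
        refine Eq.trans ?_ (map_add (HahnSeries.ofPowerSeries ℤ (IterField n)) _ _)
        congr 1
        ext b
        simp
      map_smul' := fun c F => by
        refine HahnSeries.ext (funext fun j => ?_)
        refine Eq.trans ?_ (HahnSeries.coeff_smul (r := c) (x := HahnSeries.ofPowerSeries ℤ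
          (IterField n) (PowerSeries.mk fun b => toIterField n (slice b F))) (a := j)).symm
        rw [ofPowerSeries_coeff_int, ofPowerSeries_coeff_int]
        split_ifs <;> simp }

theorem toIterField_succ (n : ℕ) (F : MvPowerSeries (Fin (n + 1)) ℂ) :
    toIterField (n + 1) F = HahnSeries.ofPowerSeries ℤ (IterField n)
        (PowerSeries.mk fun b => toIterField n (slice b F)) := rfl

theorem toIterField_injective : (n : ℕ) → Function.Injective (toIterField n)
  | 0 => fun F G h => by
      ext a
      rw [Subsingleton.elim a 0]
      exact h
  | n + 1 => fun F G h => slice_ext fun b => toIterField_injective n <| by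
      have := congrArg (PowerSeries.coeff b)
        (HahnSeries.ofPowerSeries_injective (Γ := ℤ) (R := IterField n) h)
      simpa using this

/-- The scalar action on a Hahn module sums over pairs of support points. A power series has
nonnegative exponents, so the pairs can be indexed by natural numbers. -/
theorem iterCoeff_ofPowerSeries_smul {n : ℕ} (g : PowerSeries (IterField n))
    (s : IterSeries V (n + 1)) (j : ℤ) {B : Finset ℕ}
    (hB : ∀ b : ℕ, iterCoeff s (j - b) ≠ 0 → b ∈ B) :
    iterCoeff ((show IterField (n + 1) from HahnSeries.ofPowerSeries ℤ (IterField n) g) • s) j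
      = ∑ b ∈ B, PowerSeries.coeff b g • iterCoeff s (j - b) := by
  classical
  have nonneg {i : ℤ} {m : IterSeries V n}
      (h : (HahnSeries.ofPowerSeries ℤ (IterField n) g).coeff i • m ≠ 0) : 0 ≤ i := by
    by_contra h0
    exact left_ne_zero_of_smul h (by rw [ofPowerSeries_coeff_int, if_neg h0])
  refine (HahnModule.coeff_smul (R := IterField n) (V := iterModule V n)
    (HahnSeries.ofPowerSeries ℤ (IterField n) g) s j).trans ?_
  refine Finset.sum_bij_ne_zero (fun x _ _ => x.1.toNat) (fun x hx h => ?_)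
    (fun x hx h y hy h' e => ?_) (fun b hb h => ?_) (fun x hx h => ?_)
  · have h0 := nonneg h
    have hx' := ((Finset.mem_vaddAntidiagonal _ _).1 hx).2.2
    refine hB _ ?_
    rw [Int.toNat_of_nonneg h0, ← hx', vadd_eq_add, add_sub_cancel_left]
    exact right_ne_zero_of_smul h
  · have hx' := ((Finset.mem_vaddAntidiagonal _ _).1 hx).2.2
    have hy' := ((Finset.mem_vaddAntidiagonal _ _).1 hy).2.2
    have h0 := nonneg h
    have h0' := nonneg h'
    rw [vadd_eq_add] at hx' hy'
    exact Prod.ext (by omega) (by omega)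
  · refine ⟨(b, j - b), (Finset.mem_vaddAntidiagonal _ _).2 ⟨?_, right_ne_zero_of_smul h, ?_⟩, ?_,
      Int.toNat_natCast b⟩
    · intro h0
      rw [ofPowerSeries_coeff_int, if_pos (Int.natCast_nonneg b), Int.toNat_natCast] at h0
      exact left_ne_zero_of_smul h h0
    · simp
    · rw [ofPowerSeries_coeff_int, if_pos (Int.natCast_nonneg b), Int.toNat_natCast]
      exact h
  · have hx' := ((Finset.mem_vaddAntidiagonal _ _).1 hx).2.2
    have h0 := nonneg h
    rw [ofPowerSeries_coeff_int, if_pos h0, Int.toNat_of_nonneg h0, ← hx', vadd_eq_add,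
      add_sub_cancel_left]
    rfl

/-- This links multiplication in the iterated Laurent field to the action on `lowFinite`: peel off
the outermost variable and recurse on its coefficients. -/
theorem coeffs_smul : (n : ℕ) → (F : MvPowerSeries (Fin n) ℂ) → (s : IterSeries V n) →
    coeffs n (toIterField n F • s) = conv F (coeffs n s)
  | 0 => fun F s => by
      funext p
      rw [conv, finsum_eq_single _ 0 fun a ha => (ha (Subsingleton.elim _ _)).elim]
      rfl
  | n + 1 => fun F s => by
      classical
      funext p
      obtain ⟨N, hN⟩ := exists_iterCoeff_eq_zero s
      have hB : ∀ b : ℕ, iterCoeff s (p (Fin.last n) - b) ≠ 0 →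
          b ∈ Finset.range (p (Fin.last n) - N + 1).toNat := fun b hb => by
        have : ¬ p (Fin.last n) - b < N := fun h => hb (hN _ h)
        rw [Finset.mem_range]
        omega
      rw [coeffs_succ, toIterField_succ, iterCoeff_ofPowerSeries_smul _ _ _ hB, map_sum,
        Finset.sum_apply, conv, ← finsum_comp_equiv (Equiv.ofBijective _ (expSnoc_bijective n)),
        finsum_curry]
      · rw [← finsum_eq_sum_of_support_subset (fun b => coeffs n (PowerSeries.coeff b
          (PowerSeries.mk fun b => toIterField n (slice b F)) •
            iterCoeff s (p (Fin.last n) - b)) (Fin.init p))]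
        · refine finsum_congr fun b => ?_
          rw [PowerSeries.coeff_mk, coeffs_smul n]
          refine finsum_congr fun a => ?_
          rw [coeff_slice, Equiv.ofBijective_apply, coeffs_succ, expSub_expSnoc_last,
            init_expSub_expSnoc]
        · intro b hb
          refine hB b fun h => hb ?_
          simp only [h, smul_zero, map_zero]
          rfl
      -- Splitting the sum over exponents into an iterated sum needs finite support, which low
      -- finiteness gives.
      · refine ((finite_expSub (coeffs_mem (n + 1) s) p).preimage
          (Equiv.ofBijective _ (expSnoc_bijective n)).injective.injOn).subset fun x hx => ?_
        exact right_ne_zero_of_smul hx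

end IteratedCoefficients

end

/-! ### Products of three fields and the injectivity hypothesis -/

section

variable {V : Type u} [AddCommGroup V] [Module ℂ V]

section Correlator

/-- The coefficients of an iterated Laurent series, as an element of `lowFinite`. -/
def coeffsLow (n : ℕ) : IterSeries V n →ₗ[ℂ] lowFinite (Fin n) V :=
  (coeffs n).codRestrict _ (coeffs_mem n)

variable (Y : V →ₗ[ℂ] VertexOperator ℂ V)

/-- The distribution `Y(y_{σ 0}, x_{σ 0}) Y(y_{σ 1}, x_{σ 1}) Y(y_{σ 2}, x_{σ 2}) w`, as a
multilinear function of `y`; the vector `y i` goes with the variable `x i`. -/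
def ordered (σ : Equiv.Perm (Fin 3)) (w : V) :
    MultilinearMap ℂ (fun _ : Fin 3 => V) (lowFinite (Fin 3) V) :=
  (reindex σ).compMultilinearMap
    (((coeffsLow 3 ∘ₗ LinearMap.applyₗ w).compMultilinearMap (fieldProduct Y 3)).domDomCongr σ)

theorem ordered_apply (σ : Equiv.Perm (Fin 3)) (w : V) (y : Fin 3 → V) (p : Fin 3 → ℤ) :
    (ordered Y σ w y).1 p = HVertexOperator.coeff (Y (y (σ 0))) (p (σ 0))
      (HVertexOperator.coeff (Y (y (σ 1))) (p (σ 1))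
        (HVertexOperator.coeff (Y (y (σ 2))) (p (σ 2)) w)) := rfl

/-- The `ℂ[[x₀, x₁, x₂]]`-linear extension of `ordered`. -/
def corr (σ : Equiv.Perm (Fin 3)) (w : V) :
    (PiTensorProduct ℂ (fun _ : Fin 3 => V)) ⊗[ℂ] MvPowerSeries (Fin 3) ℂ →ₗ[ℂ]
      lowFinite (Fin 3) V :=
  TensorProduct.lift (LinearMap.mk₂ ℂ (fun x F => F • PiTensorProduct.lift (ordered Y σ w) x)
    (fun x y F => by rw [map_add, smul_add])
    (fun c x F => by rw [map_smul, smul_comm])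
    (fun x F G => add_smul _ _ _)
    (fun c x F => smul_assoc _ _ _))

theorem corr_tmul (σ : Equiv.Perm (Fin 3)) (w : V)
    (x : PiTensorProduct ℂ (fun _ : Fin 3 => V)) (F : MvPowerSeries (Fin 3) ℂ) :
    corr Y σ w (x ⊗ₜ F) = F • PiTensorProduct.lift (ordered Y σ w) x := rfl

theorem corr_mulLeft (σ : Equiv.Perm (Fin 3)) (w : V) (G : MvPowerSeries (Fin 3) ℂ)
    (t : (PiTensorProduct ℂ (fun _ : Fin 3 => V)) ⊗[ℂ] MvPowerSeries (Fin 3) ℂ) :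
    corr Y σ w ((LinearMap.mulLeft ℂ G).lTensor _ t) = G • corr Y σ w t := by
  induction t with
  | zero => simp
  | add s t hs ht => rw [map_add, map_add, map_add, hs, ht, smul_add]
  | tmul x F => rw [LinearMap.lTensor_tmul, corr_tmul, corr_tmul, LinearMap.mulLeft_apply, mul_smul]

/-- The identity order is the one in which `corr` and `piMap` can be compared: the series are
expanded as in ℂ((x₁))((x₂))((x₃)). -/
theorem coeffsLow_piMap (w : V)
    (t : (PiTensorProduct ℂ (fun _ : Fin 3 => V)) ⊗[ℂ] MvPowerSeries (Fin 3) ℂ) :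
    coeffsLow 3 (piMap Y 3 ((toIterField 3).lTensor _ t) w) = corr Y 1 w t := by
  induction t with
  | zero => simp
  | add s t hs ht => simp only [map_add, LinearMap.add_apply, hs, ht]
  | tmul x F =>
    rw [LinearMap.lTensor_tmul, corr_tmul]
    induction x using PiTensorProduct.induction_on with
    | smul_tprod c v =>
      rw [← TensorProduct.smul_tmul', map_smul, map_smul, LinearMap.smul_apply, map_smul,
        piMap_tprod, smul_comm F, PiTensorProduct.lift.tprod]
      congr 1
      exact Subtype.ext (coeffs_smul 3 F _)
    | add a b ha hb =>
      rw [TensorProduct.add_tmul, map_add, LinearMap.add_apply, map_add, ha, hb, map_add, smul_add]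

/-- The form in which injectivity of π₃ is used. Flatness over ℂ keeps the passage from power series
to iterated Laurent scalars injective after tensoring with V^{⊗3}. -/
theorem eq_zero_of_corr_eq_zero (h : Function.Injective (piMap Y 3))
    (t : (PiTensorProduct ℂ (fun _ : Fin 3 => V)) ⊗[ℂ] MvPowerSeries (Fin 3) ℂ)
    (ht : ∀ w, corr Y 1 w t = 0) : t = 0 := by
  apply Module.Flat.lTensor_preserves_injective_linearMap (toIterField 3)
    (toIterField_injective 3)
  apply h
  rw [map_zero, map_zero]
  refine LinearMap.ext fun w => coeffs_injective 3 ?_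
  have := congrArg Subtype.val ((coeffsLow_piMap Y w t).trans (ht w))
  exact this.trans (map_zero (coeffs 3)).symm

end Correlator

end

/-! ### From the Jacobi identity to locality with power series coefficients -/

section

section MulSubPow

variable {V : Type u} [AddCommGroup V]

/-- The shift `F m n ↦ F (m + 1) n`. -/
def shiftLeft : Module.End ℤ (ℤ → ℤ → V) where
  toFun F m n := F (m + 1) n
  map_add' _ _ := rfl
  map_smul' _ _ := rfl

/-- The shift `F m n ↦ F m (n + 1)`. -/
def shiftRight : Module.End ℤ (ℤ → ℤ → V) where
  toFun F m n := F m (n + 1)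
  map_add' _ _ := rfl
  map_smul' _ _ := rfl

theorem shiftLeft_pow (k : ℕ) (F : ℤ → ℤ → V) (m n : ℤ) :
    (shiftLeft ^ k : Module.End ℤ (ℤ → ℤ → V)) F m n = F (m + k) n := by
  induction k generalizing m with
  | zero => simp
  | succ k ih =>
    rw [pow_succ']
    change (shiftLeft ^ k : Module.End ℤ (ℤ → ℤ → V)) F (m + 1) n = _
    rw [ih]
    congr 1
    push_cast
    ring

theorem shiftRight_pow (k : ℕ) (F : ℤ → ℤ → V) (m n : ℤ) :
    (shiftRight ^ k : Module.End ℤ (ℤ → ℤ → V)) F m n = F m (n + k) := by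
  induction k generalizing n with
  | zero => simp
  | succ k ih =>
    rw [pow_succ']
    change (shiftRight ^ k : Module.End ℤ (ℤ → ℤ → V)) F m (n + 1) = _
    rw [ih]
    congr 1
    push_cast
    ring

/-- Multiplication by x₁ or x₂ raises the corresponding mode index by one, and the two shifts
commute, so the binomial theorem applies. Recursion in `k` is then immediate. -/
theorem mulSubPow_eq (k : ℕ) (F : ℤ → ℤ → V) :
    mulSubPow k F = ((shiftLeft - shiftRight) ^ k : Module.End ℤ (ℤ → ℤ → V)) F := by
  have hc : Commute (-shiftRight : Module.End ℤ (ℤ → ℤ → V)) shiftLeft :=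
    Commute.neg_left rfl
  funext m n
  rw [sub_eq_neg_add, hc.add_pow, LinearMap.sum_apply, Finset.sum_apply, Finset.sum_apply,
    mulSubPow]
  refine Finset.sum_congr rfl fun i hi => ?_
  have hi' : i ≤ k := by
    rw [Finset.mem_range] at hi
    omega
  have h1 : (-1 : Module.End ℤ (ℤ → ℤ → V)) ^ i = (((-1) ^ i : ℤ) : Module.End ℤ _) := by
    push_cast
    rfl
  rw [neg_pow shiftRight, h1, mul_assoc, mul_assoc,
    ← nsmul_eq_mul' (shiftLeft ^ (k - i) : Module.End ℤ (ℤ → ℤ → V)), ← zsmul_eq_mul,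
    mul_smul_comm, mul_smul, natCast_zsmul]
  change _ = ((-1) ^ i : ℤ) • (k.choose i) •
    (shiftRight ^ i : Module.End ℤ (ℤ → ℤ → V)) ((shiftLeft ^ (k - i) : Module.End ℤ _) F) m n
  rw [shiftRight_pow, shiftLeft_pow, Nat.cast_sub hi', add_sub_assoc]

theorem mulSubPow_succ (k : ℕ) (F : ℤ → ℤ → V) (m n : ℤ) :
    mulSubPow (k + 1) F m n = mulSubPow k F (m + 1) n - mulSubPow k F m (n + 1) := by
  rw [mulSubPow_eq, mulSubPow_eq, pow_succ']
  rfl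

theorem mulSubPow_congr_of_le {k K : ℕ} (hK : k ≤ K) {F G : ℤ → ℤ → V}
    (h : ∀ m n, mulSubPow k F m n = mulSubPow k G m n) (m n : ℤ) :
    mulSubPow K F m n = mulSubPow K G m n := by
  induction K, hK using Nat.le_induction generalizing m n with
  | base => exact h m n
  | succ K _ ih => rw [mulSubPow_succ, mulSubPow_succ, ih, ih]

theorem mulSubPow_sum {α : Type*} (B : Finset α) (k : ℕ) (F : α → ℤ → ℤ → V) (m n : ℤ) :
    mulSubPow k (fun a b => ∑ i ∈ B, F i a b) m n = ∑ i ∈ B, mulSubPow k (F i) m n := by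
  simp only [mulSubPow, Finset.smul_sum]
  exact Finset.sum_comm

end MulSubPow

section Locality

variable {V : Type u} [AddCommGroup V] [Module ℂ V]
variable (Y : V →ₗ[ℂ] VertexOperator ℂ V)

theorem exists_coeff_eq_zero (v w : V) :
    ∃ N : ℤ, ∀ n < N, HVertexOperator.coeff (Y v) n w = 0 :=
  ⟨_, fun n hn => VertexOperator.coeff_eq_zero_of_lt_order (Y v) n w hn⟩

theorem exists_mode_eq_zero (v w : V) : ∃ N : ℤ, ∀ n ≥ N, mode Y v n w = 0 := by
  obtain ⟨N, hN⟩ := exists_coeff_eq_zero Y v w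
  exact ⟨-N, fun n hn => hN _ (by omega)⟩

/-- Truncation of Y(u,x)w bounds the second index; for each of its values the first is bounded below
by the order of `f` and above by truncation of the outer field. -/
theorem finite_mode_mode (f : LaurentSeries ℂ) (v u w : V) (m n : ℤ) :
    {p : ℤ × ℕ | f.coeff p.1 ≠ 0 ∧ mode Y v (n + p.1 - p.2) (mode Y u (m + p.2) w) ≠ 0}.Finite := by
  obtain ⟨N, hN⟩ := exists_mode_eq_zero Y u w
  choose M hM using fun k : ℕ => exists_mode_eq_zero Y v (mode Y u (m + k) w)
  refine ((Finset.range (N - m).toNat).finite_toSet.biUnion fun k _ =>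
    (Set.finite_Icc f.order (M k + k - n)).image fun j => (j, k)).subset fun p hp => ?_
  refine Set.mem_biUnion (x := p.2) ?_ ⟨p.1, ⟨?_, ?_⟩, rfl⟩
  · by_contra h
    refine hp.2 ?_
    rw [hN _ (by simp at h; omega), map_zero]
  · exact HahnSeries.order_le_of_coeff_ne_zero hp.1
  · by_contra h
    exact hp.2 (hM p.2 _ (by omega))

theorem finite_coeff_coeff (v u w : V) (a b : ℤ) :
    {x : ℕ × ℕ | HVertexOperator.coeff (Y v) (b - x.1)
      (HVertexOperator.coeff (Y u) (a - x.2) w) ≠ 0}.Finite := by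
  obtain ⟨N, hN⟩ := exists_coeff_eq_zero Y u w
  choose M hM using fun k : ℕ =>
    exists_coeff_eq_zero Y v (HVertexOperator.coeff (Y u) (a - k) w)
  refine ((Finset.range (a - N + 1).toNat).finite_toSet.biUnion fun k _ =>
    (Finset.range (b - M k + 1).toNat).finite_toSet.image fun j => (j, k)).subset fun x hx => ?_
  refine Set.mem_biUnion (x := x.2) ?_ ⟨x.1, ?_, rfl⟩
  · by_contra h
    refine hx ?_
    rw [hN _ (by simp at h; omega), map_zero]
  · by_contra h
    exact hx (hM x.2 _ (by simp at h; omega))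

/-- Because of the delta function, raising `l` by one amounts to multiplying by x₁ - x₂. On
coefficients this is Pascal's rule. -/
theorem jacobiRight_succ (f : LaurentSeries ℂ) (v u w : V) (l m n : ℤ) :
    jacobiRight Y f v u w (l + 1) m n
      = jacobiRight Y f v u w l (m + 1) n - jacobiRight Y f v u w l m (n + 1) := by
  -- The summands for (m + 1, n) with second index moved up by one, extended by zero at index 0; now
  -- all three sums involve the same modes.
  set a' : ℤ × ℕ → V := fun p => (((-1 : ℂ) ^ (l + 1) * f.coeff p.1) *
      (((-1) ^ p.2 * (p.2.casesOn 0 fun k => Ring.choose (l + p.1) k) : ℤ) : ℂ)) •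
    mode Y v (n + (l + 1) + p.1 - p.2) (mode Y u (m + p.2) w) with ha'
  have h1 : jacobiRight Y f v u w l (m + 1) n = ∑ᶠ p, a' p := by
    rw [finsum_eq_finsum_comp (g := fun p : ℤ × ℕ => (p.1, p.2 + 1))]
    · refine finsum_congr fun p => ?_
      simp only [ha']
      congr 1
      · rw [zpow_add_one₀ (by norm_num)]
        push_cast
        ring
      · refine congrArg₂ (fun N M => mode Y v N (mode Y u M w)) ?_ ?_ <;> push_cast <;> ring
    · rintro ⟨j, k⟩ ⟨j', k'⟩ h
      simpa using h
    · rintro ⟨j, k⟩ h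
      cases k with
      | zero => simp [ha'] at h
      | succ k => exact ⟨(j, k), rfl⟩
  rw [h1]
  unfold jacobiRight
  rw [← finsum_sub_distrib]
  · refine finsum_congr fun p => ?_
    obtain ⟨j, k⟩ := p
    have e : n + 1 + l + j - k = n + (l + 1) + j - k := by ring
    simp only [ha', e, ← sub_smul]
    congr 1
    rw [zpow_add_one₀ (by norm_num), add_right_comm l 1 j]
    cases k with
    | zero => simp
    | succ k =>
      rw [Ring.choose_succ_succ]
      push_cast
      ring
  · refine (finite_mode_mode Y f v u w m (n + (l + 1))).subset fun p hp => ⟨fun h => hp ?_,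
      right_ne_zero_of_smul hp⟩
    simp [ha', h]
  · refine (finite_mode_mode Y f v u w m (n + 1 + l)).subset fun p hp => ⟨fun h => hp ?_,
      right_ne_zero_of_smul hp⟩
    simp [h]

theorem mulSubPow_jacobiRight (f : LaurentSeries ℂ) (v u w : V) (k : ℕ) (m n : ℤ) :
    mulSubPow k (fun a b => jacobiRight Y f v u w 0 a b) m n = jacobiRight Y f v u w k m n := by
  induction k generalizing m n with
  | zero => simp [mulSubPow]
  | succ k ih => rw [mulSubPow_succ, ih, ih, Nat.cast_succ, jacobiRight_succ]

theorem jacobiLeft_natCast (u v w : V) (k : ℕ) (m n : ℤ) :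
    jacobiLeft Y u v w k m n = mulSubPow k (fun a b => mode Y u a (mode Y v b w)) m n := by
  rw [jacobiLeft, mulSubPow, finsum_eq_sum_of_support_subset (s := Finset.range (k + 1))]
  · simp only [Ring.choose_natCast]
  · intro i hi
    by_contra h
    refine hi ?_
    have : k < i := by simpa using h
    simp [Ring.choose_natCast, Nat.choose_eq_zero_of_lt this]

/-- For l beyond the truncation bound of Y(u,x₀)v every term of the iterate vanishes, and the
remaining coefficient of x₀^{-l-1} is locality with exponent l. -/
theorem SJacobi.sLocal {Y : V →ₗ[ℂ] VertexOperator ℂ V} {u v : V} {r : ℕ} {v' u' : Fin r → V}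
    {f : Fin r → LaurentSeries ℂ} (h : SJacobi Y u v v' u' f) : SLocal Y u v v' u' f := by
  obtain ⟨N, hN⟩ := exists_mode_eq_zero Y u v
  refine ⟨N.toNat, fun w m n => ?_⟩
  have := h w N.toNat m n
  rw [jacobiIterate, finsum_eq_zero_of_forall_eq_zero, sub_eq_zero, jacobiLeft_natCast] at this
  · rw [this, mulSubPow_sum]
    simp only [mulSubPow_jacobiRight]
  · intro i
    rw [hN _ (by omega)]
    simp [mode]

/-- The constant term of `g(x + z) G` for `G = ∑ G a b x^{-a} z^{-b}` with `z` replaced by `-z`. -/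
def binomialSum (g : PowerSeries ℂ) (G : ℕ → ℕ → V) : V :=
  ∑ᶠ x : ℕ × ℕ, (g.coeff (x.1 + x.2) * (1 ^ x.1 * (-1) ^ x.2 * (x.1 + x.2).choose x.1)) • G x.1 x.2

/-- With g = x^K f one has (x₁ - x₂)^K f(x₂ - x₁) = (-1)^K g(x₂ - x₁), and g has no poles. The mode
index -a-1 marks the coefficient of x₁^a. -/
theorem jacobiRight_natCast (f : LaurentSeries ℂ) (g : PowerSeries ℂ) (K : ℕ)
    (hg : HahnSeries.ofPowerSeries ℤ ℂ g = HahnSeries.single (K : ℤ) 1 * f) (v u w : V) (a b : ℤ) :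
    jacobiRight Y f v u w K (-a - 1) (-b - 1) = (-1 : ℂ) ^ K • binomialSum g fun i j =>
      HVertexOperator.coeff (Y v) (b - i) (HVertexOperator.coeff (Y u) (a - j) w) := by
  have hf (j : ℤ) : f.coeff j = (HahnSeries.ofPowerSeries ℤ ℂ g).coeff (j + K) := by
    rw [hg, HahnSeries.coeff_single_mul_add, one_mul]
  rw [binomialSum, smul_finsum, jacobiRight,
    -- Degree x.1 + x.2 in `g` is degree x.1 + x.2 - K in `f`. Indices outside the range vanish,
    -- either because `g` has no negative powers or by the binomial coefficient.
    finsum_eq_finsum_comp (g := fun x : ℕ × ℕ => ((x.1 + x.2 - K : ℤ), x.2))]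
  · refine finsum_congr fun x => ?_
    rw [smul_smul, hf, sub_add_cancel, ← Nat.cast_add, HahnSeries.ofPowerSeries_apply_coeff]
    congr 1
    · have : (K : ℤ) + ((x.1 + x.2 : ℕ) - K) = (x.1 + x.2 : ℕ) := by ring
      simp only [this, Ring.choose_natCast, Nat.choose_symm_add (a := x.1)]
      push_cast
      rw [zpow_natCast]
      ring
    · refine congrArg₂ (fun N M => HVertexOperator.coeff (Y v) N
        (HVertexOperator.coeff (Y u) M w)) ?_ ?_ <;> push_cast <;> ring
  · rintro ⟨i, j⟩ ⟨i', j'⟩ h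
    simp only [Prod.mk.injEq] at h ⊢
    omega
  · rintro ⟨j, k⟩ h
    have h1 := left_ne_zero_of_smul h
    have h2 : f.coeff j ≠ 0 := fun h0 => h1 (by simp [h0])
    have h3 : Ring.choose ((K : ℤ) + j) k ≠ 0 := fun h0 => h1 (by simp [h0])
    rw [hf, ofPowerSeries_coeff_int] at h2
    have h4 : 0 ≤ j + K := by
      by_contra h
      exact h2 (if_neg h)
    obtain ⟨d, hd⟩ := Int.eq_ofNat_of_zero_le h4
    rw [add_comm, hd, Ring.choose_natCast] at h3
    have h5 : k ≤ d := by
      by_contra h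
      exact h3 (by rw [Nat.choose_eq_zero_of_lt (not_le.1 h), Nat.cast_zero])
    refine ⟨(d - k, k), Prod.ext ?_ rfl⟩
    simp only
    omega

theorem mulSubPow_eq_binomialSum (u v w : V) (K : ℕ) (a b : ℤ) :
    mulSubPow K (fun a b => mode Y u a (mode Y v b w)) (-a - 1) (-b - 1)
      = (-1 : ℂ) ^ K • binomialSum (PowerSeries.X ^ K) fun i j =>
        HVertexOperator.coeff (Y u) (a - j) (HVertexOperator.coeff (Y v) (b - i) w) := by
  rw [binomialSum, smul_finsum, mulSubPow,
    finsum_eq_sum_of_support_subset (s := (Finset.HasAntidiagonal.antidiagonal K : Finset (ℕ × ℕ))),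
    Finset.Nat.sum_antidiagonal_eq_sum_range_succ_mk]
  · refine Finset.sum_congr rfl fun i hi => ?_
    have hi' : i ≤ K := by
      rw [Finset.mem_range] at hi
      omega
    obtain ⟨j, rfl⟩ := Nat.exists_eq_add_of_le hi'
    rw [smul_smul, ← Int.cast_smul_eq_zsmul ℂ, Nat.add_sub_cancel_left,
      PowerSeries.coeff_X_pow_self]
    congr 1
    · have : (-1 : ℂ) ^ (j * 2) = 1 := by rw [mul_comm, pow_mul]; norm_num
      push_cast
      rw [pow_add, one_pow, one_mul, one_mul, ← mul_assoc, mul_assoc ((-1) ^ i), ← pow_add,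
        ← mul_two, this, mul_one]
    · refine congrArg₂ (fun N M => HVertexOperator.coeff (Y u) N
        (HVertexOperator.coeff (Y v) M w)) ?_ ?_ <;> push_cast <;> ring
  · intro x hx
    have h1 := left_ne_zero_of_smul (right_ne_zero_of_smul hx)
    rw [PowerSeries.coeff_X_pow] at h1
    rw [Finset.mem_coe, Finset.HasAntidiagonal.mem_antidiagonal]
    by_contra h
    exact h1 (by rw [if_neg h, zero_mul])

/-- Both sides carry the same sign (-1)^K from x₁ - x₂ = -(x₂ - x₁); cancelling it leaves power
series evaluated at x₂ - x₁. -/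
theorem SLocal.binomialSum_eq {Y : V →ₗ[ℂ] VertexOperator ℂ V} {u v : V} {r : ℕ} {v' u' : Fin r → V}
    {f : Fin r → LaurentSeries ℂ} (h : SLocal Y u v v' u' f) :
    ∃ k : ℕ, ∀ K ≥ k, ∀ g : Fin r → PowerSeries ℂ,
      (∀ i, HahnSeries.ofPowerSeries ℤ ℂ (g i) = HahnSeries.single (K : ℤ) 1 * f i) →
      ∀ w a b, binomialSum (PowerSeries.X ^ K) (fun i j =>
        HVertexOperator.coeff (Y u) (a - j) (HVertexOperator.coeff (Y v) (b - i) w))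
      = ∑ q, binomialSum (g q) fun i j =>
        HVertexOperator.coeff (Y (v' q)) (b - i) (HVertexOperator.coeff (Y (u' q)) (a - j) w) := by
  obtain ⟨k, hk⟩ := h
  refine ⟨k, fun K hK g hg w a b => ?_⟩
  have h1 := mulSubPow_congr_of_le hK (hk w) (-a - 1) (-b - 1)
  rw [mulSubPow_sum, mulSubPow_eq_binomialSum] at h1
  simp only [mulSubPow_jacobiRight, jacobiRight_natCast Y _ _ K (hg _)] at h1
  rw [← Finset.smul_sum] at h1
  exact smul_right_injective V (pow_ne_zero K (by norm_num : (-1 : ℂ) ≠ 0)) h1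

end Locality

end

/-! ### Locality inside products of three fields -/

section

variable {V : Type u} [AddCommGroup V] [Module ℂ V]

section Scalars

/-- Multiplication of the second factor of `U ⊗ A` by `a`. -/
def mulBy (U : Type u) [AddCommGroup U] [Module ℂ U] (A : Type) [CommRing A] [Algebra ℂ A] (a : A) :
    U ⊗[ℂ] A →ₗ[ℂ] U ⊗[ℂ] A :=
  (LinearMap.mulLeft ℂ a).lTensor U

variable {U : Type u} [AddCommGroup U] [Module ℂ U] {A : Type} [CommRing A] [Algebra ℂ A]

theorem mulBy_tmul (a b : A) (x : U) : mulBy U A a (x ⊗ₜ b) = x ⊗ₜ (a * b) := rfl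

theorem mulBy_mul (a b : A) (t : U ⊗[ℂ] A) : mulBy U A (a * b) t = mulBy U A a (mulBy U A b t) := by
  rw [mulBy, LinearMap.mulLeft_mul, LinearMap.lTensor_comp]
  rfl

theorem mulBy_one (t : U ⊗[ℂ] A) : mulBy U A 1 t = t := by
  rw [mulBy, LinearMap.mulLeft_one, LinearMap.lTensor_id]
  rfl

theorem mulBy_injective {a : A} (ha : IsUnit a) : Function.Injective (mulBy U A a) := by
  obtain ⟨b, hb⟩ := ha.exists_left_inv
  exact Function.LeftInverse.injective (g := mulBy U A b) fun t => by
    rw [← mulBy_mul, hb, mulBy_one]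

end Scalars

section PowerSeriesPart

/-- The inclusion of `ℂ[[x]]` in `ℂ((x))`. -/
def toLaurent : PowerSeries ℂ →ₗ[ℂ] LaurentSeries ℂ where
  toFun := HahnSeries.ofPowerSeries ℤ ℂ
  map_add' f g := map_add _ f g
  map_smul' c f := HahnSeries.ext <| funext fun j => by
    rw [RingHom.id_apply, HahnSeries.coeff_smul, ofPowerSeries_coeff_int, ofPowerSeries_coeff_int]
    split_ifs <;> simp

theorem toLaurent_apply (g : PowerSeries ℂ) : toLaurent g = HahnSeries.ofPowerSeries ℤ ℂ g := rfl

theorem exists_toLaurent_eq (f : LaurentSeries ℂ) :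
    ∃ k : ℕ, ∀ K ≥ k, ∃ g : PowerSeries ℂ, toLaurent g = HahnSeries.single (K : ℤ) 1 * f := by
  refine ⟨(-f.order).toNat, fun K hK => ?_⟩
  obtain ⟨d, hd⟩ := Int.eq_ofNat_of_zero_le (show 0 ≤ K + f.order by omega)
  refine ⟨PowerSeries.X ^ d * f.powerSeriesPart, ?_⟩
  rw [toLaurent_apply, map_mul, HahnSeries.ofPowerSeries_X_pow]
  conv_rhs => rw [← LaurentSeries.single_order_mul_powerSeriesPart f]
  rw [← mul_assoc, HahnSeries.single_mul_single, one_mul, hd]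

end PowerSeriesPart

section Locality

variable (Y : V →ₗ[ℂ] VertexOperator ℂ V)

/-- The substitution `x ↦ x_j - x_i`. -/
def diffSubst (i j : Fin 3) : PowerSeries ℂ →ₐ[ℂ] MvPowerSeries (Fin 3) ℂ :=
  PowerSeries.substAlgHom (hasSubst_linear 1 (-1) j i)

/-- `a ⊗ b ↦ y₀ ⊗ y₁ ⊗ y₂` with `y_j` replaced by `a` and `y_i` by `b`. -/
def insertPair (y : Fin 3 → V) {i j : Fin 3} (hij : i ≠ j) :
    V ⊗[ℂ] V →ₗ[ℂ] PiTensorProduct ℂ (fun _ : Fin 3 => V) :=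
  TensorProduct.lift (LinearMap.mk₂ ℂ
    (fun a b => PiTensorProduct.tprod ℂ (Function.update (Function.update y i b) j a))
    (fun a a' b => MultilinearMap.map_update_add _ _ _ _ _)
    (fun c a b => MultilinearMap.map_update_smul _ _ _ _ _)
    (fun a b b' => by
      simp only [Function.update_comm hij]
      exact MultilinearMap.map_update_add _ _ _ _ _)
    (fun c a b => by
      simp only [Function.update_comm hij]
      exact MultilinearMap.map_update_smul _ _ _ _ _))

theorem insertPair_tmul (y : Fin 3 → V) {i j : Fin 3} (hij : i ≠ j) (a b : V) :
    insertPair y hij (a ⊗ₜ b)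
      = PiTensorProduct.tprod ℂ (Function.update (Function.update y i b) j a) := rfl

theorem castSucc_ne (σ : Equiv.Perm (Fin 3)) (l : Fin 2) : σ l.castSucc ≠ σ l.succ :=
  fun h => (Fin.castSucc_lt_succ (i := l)).ne (σ.injective h)

/-- `σ` with the neighbouring positions `l` and `l + 1` interchanged. -/
def swapAt (σ : Equiv.Perm (Fin 3)) (l : Fin 2) : Equiv.Perm (Fin 3) :=
  σ * Equiv.swap l.castSucc l.succ

/-- The pair `x = v ⊗ u` and `t = ∑ v' ⊗ u' ⊗ f` is local inside products of three fields:
`(x_j - x_i)^K Y(u, x_i) Y(v, x_j) = ∑ (x_j - x_i)^K f(x_j - x_i) Y(v', x_j) Y(u', x_i)`, where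
`g = ∑ v' ⊗ u' ⊗ x^K f` has no poles. -/
structure LocalityWitness (x : V ⊗[ℂ] V) (t : (V ⊗[ℂ] V) ⊗[ℂ] LaurentSeries ℂ) (K : ℕ)
    (g : (V ⊗[ℂ] V) ⊗[ℂ] PowerSeries ℂ) : Prop where
  clear : mulBy (V ⊗[ℂ] V) (LaurentSeries ℂ) (HahnSeries.single (K : ℤ) 1) t = toLaurent.lTensor _ g
  exchange : ∀ (σ : Equiv.Perm (Fin 3)) (l : Fin 2) (w : V) (y : Fin 3 → V),
    corr Y σ w (insertPair y (castSucc_ne σ l) x ⊗ₜ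
        diffSubst (σ l.castSucc) (σ l.succ) (PowerSeries.X ^ K))
      = corr Y (swapAt σ l) w (TensorProduct.map (insertPair y (castSucc_ne σ l))
        (diffSubst (σ l.castSucc) (σ l.succ)).toLinearMap g)

/-- Locality of the pair `x = v ⊗ u` and `t = ∑ v' ⊗ u' ⊗ f`. -/
def IsLocal (x : V ⊗[ℂ] V) (t : (V ⊗[ℂ] V) ⊗[ℂ] LaurentSeries ℂ) : Prop :=
  ∃ (K : ℕ) (g : (V ⊗[ℂ] V) ⊗[ℂ] PowerSeries ℂ), LocalityWitness Y x t K g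

theorem binomialSum_map (L : V →ₗ[ℂ] V) (g : PowerSeries ℂ) {G : ℕ → ℕ → V}
    (hG : {x : ℕ × ℕ | G x.1 x.2 ≠ 0}.Finite) :
    L (binomialSum g G) = binomialSum g fun i j => L (G i j) := by
  rw [binomialSum, map_finsum]
  · simp only [map_smul]
    rfl
  · exact hG.subset fun x hx => right_ne_zero_of_smul hx

theorem diffSubst_smul_ordered (σ : Equiv.Perm (Fin 3)) (w : V) (y : Fin 3 → V) {i j : Fin 3}
    (hij : i ≠ j) (g : PowerSeries ℂ) (p : Fin 3 → ℤ) :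
    (diffSubst i j g • ordered Y σ w y).1 p = binomialSum g fun a b =>
      (ordered Y σ w y).1 (expSub p (Finsupp.single j a + Finsupp.single i b)) := by
  rw [diffSubst, PowerSeries.coe_substAlgHom, subst_linear_smul_apply 1 (-1) hij.symm]
  rfl

theorem expSub_single_left (p : Fin 3 → ℤ) {i j : Fin 3} (hij : i ≠ j) (a b : ℕ) :
    expSub p (Finsupp.single j a + Finsupp.single i b) j = p j - a := by
  simp [expSub, hij]

theorem expSub_single_right (p : Fin 3 → ℤ) {i j : Fin 3} (hij : i ≠ j) (a b : ℕ) :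
    expSub p (Finsupp.single j a + Finsupp.single i b) i = p i - b := by
  simp [expSub, hij.symm]

theorem expSub_single_of_ne (p : Fin 3 → ℤ) {i j k : Fin 3} (hi : k ≠ i) (hj : k ≠ j) (a b : ℕ) :
    expSub p (Finsupp.single j a + Finsupp.single i b) k = p k := by
  simp [expSub, hi, hj]

/-- Locality holds on every vector and at every pair of exponents, so a third field may stand on
either side of the exchanged pair. -/
theorem SLocal.isLocal {Y : V →ₗ[ℂ] VertexOperator ℂ V} {u v : V} {r : ℕ} {v' u' : Fin r → V}
    {f : Fin r → LaurentSeries ℂ} (h : SLocal Y u v v' u' f) :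
    IsLocal Y (v ⊗ₜ u) (∑ q, (v' q ⊗ₜ u' q) ⊗ₜ f q) := by
  obtain ⟨k, hk⟩ := h.binomialSum_eq
  choose k' hk' using fun q => exists_toLaurent_eq (f q)
  -- Large enough both for locality and to clear the pole of every `f q`.
  set K := k + ∑ q, k' q with hK
  choose g hg using fun q => hk' q K
    ((Finset.single_le_sum (fun _ _ => Nat.zero_le _) (Finset.mem_univ q)).trans
      (Nat.le_add_left _ _))
  refine ⟨K, ∑ q, (v' q ⊗ₜ u' q) ⊗ₜ g q, ?_, fun σ l w y => Subtype.ext <| funext fun p => ?_⟩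
  · simp only [map_sum, LinearMap.lTensor_tmul, mulBy_tmul, hg]
  · have key := hk K (Nat.le_add_right _ _) g hg
    simp only [map_sum, TensorProduct.map_tmul, corr_tmul, insertPair_tmul,
      PiTensorProduct.lift.tprod, AlgHom.toLinearMap_apply]
    rw [diffSubst_smul_ordered Y _ _ _ (castSucc_ne σ l), AddSubmonoidClass.coe_finsetSum,
      Finset.sum_apply]
    simp only [diffSubst_smul_ordered Y _ _ _ (castSucc_ne σ l)]
    have h01 : σ 0 ≠ σ 1 := fun h => by simpa using σ.injective h
    have h02 : σ 0 ≠ σ 2 := fun h => by simpa using σ.injective h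
    have h12 : σ 1 ≠ σ 2 := fun h => by simpa using σ.injective h
    fin_cases l
    -- Pair on the left: apply locality to the vector produced by the third field.
    · have e0 : swapAt σ 0 0 = σ 1 := by simp [swapAt]
      have e1 : swapAt σ 0 1 = σ 0 := by simp [swapAt]
      have e2 : swapAt σ 0 2 = σ 2 := by
        simp [swapAt, Equiv.swap_apply_of_ne_of_ne]
      have c0 : (Fin.castSucc (0 : Fin 2)) = 0 := rfl
      have c1 : (Fin.succ (0 : Fin 2)) = 1 := rfl
      simp only [Fin.zero_eta, ordered_apply, e0, e1, e2, c0, c1, expSub_single_left p h01,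
        expSub_single_right p h01,
        expSub_single_of_ne p h02.symm h12.symm, Function.update_self,
        Function.update_of_ne h01, Function.update_of_ne h02.symm, Function.update_of_ne h12.symm]
      exact key _ _ _
    · have e0 : swapAt σ 1 0 = σ 0 := by
        simp [swapAt, Equiv.swap_apply_of_ne_of_ne]
      have e1 : swapAt σ 1 1 = σ 2 := by simp [swapAt]
      have e2 : swapAt σ 1 2 = σ 1 := by simp [swapAt]
      have c0 : (Fin.castSucc (1 : Fin 2)) = 1 := rfl
      have c1 : (Fin.succ (1 : Fin 2)) = 2 := rfl
      simp only [Fin.mk_one, ordered_apply, e0, e1, e2, c0, c1, expSub_single_left p h12,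
        expSub_single_right p h12,
        expSub_single_of_ne p h01 h02, Function.update_self,
        Function.update_of_ne h12, Function.update_of_ne h01, Function.update_of_ne h02]
      -- Pair on the right: the coefficient of the leftmost field is a linear map, and it passes
      -- through the sums because they are finite.
      rw [← binomialSum_map, key, map_sum]
      · refine Finset.sum_congr rfl fun q _ => ?_
        exact binomialSum_map _ _ (finite_coeff_coeff Y _ _ _ _ _)
      · exact (finite_coeff_coeff Y u v w (p (σ 2)) (p (σ 1))).preimage
          Prod.swap_injective.injOn

end Locality

end

/-! ### Uniqueness of the exchanged element and construction of S -/

section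

section Scalars

variable {U U' : Type u} [AddCommGroup U] [Module ℂ U] [AddCommGroup U'] [Module ℂ U']
  {A B : Type} [CommRing A] [Algebra ℂ A] [CommRing B] [Algebra ℂ B]

theorem map_mulBy (f : U →ₗ[ℂ] U') (φ : A →ₗ[ℂ] B) {a : A} {b : B}
    (h : ∀ x, φ (a * x) = b * φ x) (t : U ⊗[ℂ] A) :
    TensorProduct.map f φ (mulBy U A a t) = mulBy U' B b (TensorProduct.map f φ t) := by
  induction t with
  | zero => simp
  | add s t hs ht => simp only [map_add, hs, ht]
  | tmul x y => simp only [mulBy_tmul, TensorProduct.map_tmul, h]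

theorem tensorMap_injective {f : U →ₗ[ℂ] U'} {φ : A →ₗ[ℂ] B} (hf : Function.Injective f)
    (hφ : Function.Injective φ) : Function.Injective (TensorProduct.map f φ) := by
  rw [← LinearMap.rTensor_comp_lTensor, LinearMap.coe_comp]
  exact (Module.Flat.rTensor_preserves_injective_linearMap f hf).comp
    (Module.Flat.lTensor_preserves_injective_linearMap φ hφ)

end Scalars

variable {V : Type u} [AddCommGroup V] [Module ℂ V]

theorem corr_mulBy (Y : V →ₗ[ℂ] VertexOperator ℂ V) (σ : Equiv.Perm (Fin 3)) (w : V)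
    (G : MvPowerSeries (Fin 3) ℂ)
    (t : (PiTensorProduct ℂ (fun _ : Fin 3 => V)) ⊗[ℂ] MvPowerSeries (Fin 3) ℂ) :
    corr Y σ w (mulBy _ _ G t) = G • corr Y σ w t := corr_mulLeft Y σ w G t

section Triples

/-- `y₀ ⊗ y₁ ⊗ y₂ ↦ (y₀ ⊗ y₁) ⊗ y₂`. -/
def toTriple : PiTensorProduct ℂ (fun _ : Fin 3 => V) →ₗ[ℂ] (V ⊗[ℂ] V) ⊗[ℂ] V :=
  PiTensorProduct.lift (MultilinearMap.mk' (fun y : Fin 3 → V => (y 0 ⊗ₜ y 1) ⊗ₜ y 2)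
    (fun y i a b => by fin_cases i <;> simp [TensorProduct.add_tmul, TensorProduct.tmul_add])
    (fun y i c a => by fin_cases i <;> simp [TensorProduct.smul_tmul']))

theorem toTriple_tprod (y : Fin 3 → V) :
    toTriple (PiTensorProduct.tprod ℂ y) = (y 0 ⊗ₜ y 1) ⊗ₜ y 2 := by
  simp [toTriple]

/-- Displays the third slot as an update, so that multilinearity applies in `c`. -/
theorem update_update_eq {M : Type*} [Zero M] (a b c : M) :
    Function.update (Function.update ![0, 0, c] 1 b) 0 a = Function.update ![a, b, 0] 2 c := by
  funext i
  fin_cases i <;> simp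

/-- `(a ⊗ b) ⊗ c ↦ a ⊗ b ⊗ c`. -/
def ofTriple : (V ⊗[ℂ] V) ⊗[ℂ] V →ₗ[ℂ] PiTensorProduct ℂ (fun _ : Fin 3 => V) :=
  TensorProduct.lift (LinearMap.mk₂ ℂ
    (fun t c => insertPair ![0, 0, c] (by decide : (1 : Fin 3) ≠ 0) t)
    (fun s t c => map_add _ _ _) (fun c t d => map_smul _ _ _)
    (fun t c c' => by
      induction t with
      | zero => simp
      | add s t hs ht =>
        rw [map_add, hs, ht, map_add, map_add]
        abel
      | tmul a b =>
        simp only [insertPair_tmul, update_update_eq]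
        exact MultilinearMap.map_update_add _ _ _ _ _)
    (fun d t c => by
      induction t with
      | zero => simp
      | add s t hs ht => rw [map_add, hs, ht, map_add, smul_add]
      | tmul a b =>
        simp only [insertPair_tmul, update_update_eq]
        exact MultilinearMap.map_update_smul _ _ _ _ _))

theorem ofTriple_tmul (a b c : V) :
    ofTriple ((a ⊗ₜ b) ⊗ₜ c) = PiTensorProduct.tprod ℂ ![a, b, c] := by
  refine (insertPair_tmul ![0, 0, c] (by decide) a b).trans ?_
  congr 1
  funext i
  fin_cases i <;> simp

theorem toTriple_ofTriple (t : (V ⊗[ℂ] V) ⊗[ℂ] V) : toTriple (ofTriple t) = t := by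
  suffices h : toTriple ∘ₗ ofTriple = (LinearMap.id : (V ⊗[ℂ] V) ⊗[ℂ] V →ₗ[ℂ] _) from
    DFunLike.congr_fun h t
  refine TensorProduct.ext_threefold fun a b c => ?_
  simp [ofTriple_tmul, toTriple_tprod]

theorem ofTriple_injective : Function.Injective (ofTriple (V := V)) :=
  Function.LeftInverse.injective toTriple_ofTriple

/-- Contracting the third factor with a functional φ such that φ(c) ≠ 0 recovers the pair, up to a
possible flip and the scalar φ(c). -/
theorem insertPair_injective {c : V} (hc : c ≠ 0) {i j : Fin 3} (hij : i ≠ j) (hi : i ≠ 2)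
    (hj : j ≠ 2) : Function.Injective (insertPair ![0, 0, c] hij) := by
  obtain ⟨φ, hφ⟩ : ∃ φ : Module.Dual ℂ V, φ c ≠ 0 := by
    by_contra! h
    exact hc ((Module.forall_dual_apply_eq_zero_iff ℂ c).1 h)
  obtain ⟨e, he⟩ : ∃ e : V ⊗[ℂ] V ≃ₗ[ℂ] V ⊗[ℂ] V, ∀ a b,
      toTriple (insertPair ![0, 0, c] hij (a ⊗ₜ b)) = e (a ⊗ₜ b) ⊗ₜ c := by
    obtain ⟨rfl, rfl⟩ | ⟨rfl, rfl⟩ : i = 1 ∧ j = 0 ∨ i = 0 ∧ j = 1 := by omega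
    · exact ⟨LinearEquiv.refl ℂ _, fun a b => by simp [insertPair_tmul, toTriple_tprod]⟩
    · exact ⟨TensorProduct.comm ℂ V V, fun a b => by simp [insertPair_tmul, toTriple_tprod]⟩
  have key : (TensorProduct.rid ℂ (V ⊗[ℂ] V)).toLinearMap ∘ₗ φ.lTensor _ ∘ₗ toTriple ∘ₗ
      insertPair ![0, 0, c] hij = φ c • e.toLinearMap := by
    refine TensorProduct.ext' fun a b => ?_
    simp [he]
  refine Function.Injective.of_comp
    (f := (TensorProduct.rid ℂ (V ⊗[ℂ] V)).toLinearMap ∘ₗ φ.lTensor _ ∘ₗ toTriple) ?_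
  rw [← LinearMap.coe_comp, LinearMap.comp_assoc, LinearMap.comp_assoc, key]
  exact fun s t h => e.injective (smul_right_injective _ hφ h)

end Triples

section Existence

variable {Y : V →ₗ[ℂ] VertexOperator ℂ V}

theorem diffSubst_injective {i j : Fin 3} (hij : i ≠ j) : Function.Injective (diffSubst i j) :=
  fun f g h => by
    ext n
    -- The pure power x_j^n in f(x_j - x_i) has coefficient fₙ.
    have := congrArg (MvPowerSeries.coeff (Finsupp.single j n + Finsupp.single i 0)) h
    rw [diffSubst, PowerSeries.coe_substAlgHom, coeff_subst_linear 1 (-1) hij.symm,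
      coeff_subst_linear 1 (-1) hij.symm] at this
    simpa using this

theorem toLaurent_X_pow_mul (K : ℕ) (g : PowerSeries ℂ) :
    toLaurent (PowerSeries.X ^ K * g) = HahnSeries.single (K : ℤ) 1 * toLaurent g := by
  rw [toLaurent_apply, toLaurent_apply, map_mul, HahnSeries.ofPowerSeries_X_pow]

theorem isUnit_single (K : ℤ) : IsUnit (HahnSeries.single K (1 : ℂ) : LaurentSeries ℂ) :=
  (HahnSeries.single_ne_zero one_ne_zero).isUnit

/-- Gives two witnesses a common exponent, so that they can be added or compared. -/
theorem LocalityWitness.raise {x : V ⊗[ℂ] V} {t : (V ⊗[ℂ] V) ⊗[ℂ] LaurentSeries ℂ} {K : ℕ}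
    {g : (V ⊗[ℂ] V) ⊗[ℂ] PowerSeries ℂ} (h : LocalityWitness Y x t K g) (d : ℕ) :
    LocalityWitness Y x t (d + K) (mulBy _ _ (PowerSeries.X ^ d) g) where
  clear := by
    rw [LinearMap.lTensor, map_mulBy _ _ (toLaurent_X_pow_mul d), ← LinearMap.lTensor, ← h.clear,
      ← mulBy_mul, HahnSeries.single_mul_single, one_mul, Nat.cast_add]
  exchange σ l w y := by
    rw [map_mulBy (b := diffSubst (σ l.castSucc) (σ l.succ) (PowerSeries.X ^ d)) _ _
      (fun x => map_mul (diffSubst (σ l.castSucc) (σ l.succ)) _ x), corr_mulBy, ← h.exchange,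
      ← corr_mulBy, mulBy_tmul, ← map_mul, ← pow_add]

theorem LocalityWitness.add {x x' : V ⊗[ℂ] V} {t t' : (V ⊗[ℂ] V) ⊗[ℂ] LaurentSeries ℂ} {K : ℕ}
    {g g' : (V ⊗[ℂ] V) ⊗[ℂ] PowerSeries ℂ} (h : LocalityWitness Y x t K g)
    (h' : LocalityWitness Y x' t' K g') : LocalityWitness Y (x + x') (t + t') K (g + g') where
  clear := by rw [map_add, h.clear, h'.clear, ← map_add]
  exchange σ l w y := by
    rw [map_add, TensorProduct.add_tmul, map_add, h.exchange, h'.exchange, ← map_add, ← map_add]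

theorem IsLocal.exists_common {x x' : V ⊗[ℂ] V} {t t' : (V ⊗[ℂ] V) ⊗[ℂ] LaurentSeries ℂ}
    (h : IsLocal Y x t) (h' : IsLocal Y x' t') :
    ∃ K g g', LocalityWitness Y x t K g ∧ LocalityWitness Y x' t' K g' := by
  obtain ⟨K, g, h⟩ := h
  obtain ⟨K', g', h'⟩ := h'
  exact ⟨K + K', _, _, Nat.add_comm K' K ▸ h.raise K', h'.raise K⟩

theorem IsLocal.add {x x' : V ⊗[ℂ] V} {t t' : (V ⊗[ℂ] V) ⊗[ℂ] LaurentSeries ℂ}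
    (h : IsLocal Y x t) (h' : IsLocal Y x' t') : IsLocal Y (x + x') (t + t') := by
  obtain ⟨K, g, g', h, h'⟩ := h.exists_common h'
  exact ⟨K, _, h.add h'⟩

theorem IsLocal.smul (c : ℂ) {x : V ⊗[ℂ] V} {t : (V ⊗[ℂ] V) ⊗[ℂ] LaurentSeries ℂ}
    (h : IsLocal Y x t) : IsLocal Y (c • x) (c • t) := by
  obtain ⟨K, g, h1, h2⟩ := h
  refine ⟨K, c • g, by rw [map_smul, h1, map_smul], fun σ l w y => ?_⟩
  rw [map_smul, map_smul, map_smul, ← h2, ← TensorProduct.smul_tmul', map_smul]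

/-- At a common exponent, both cleared elements give the same product of fields after the exchange.
Injectivity makes them equal, and x^K is invertible in ℂ((x)). -/
theorem IsLocal.unique (h : Function.Injective (piMap Y 3)) {c : V} (hc : c ≠ 0) {x : V ⊗[ℂ] V}
    {t t' : (V ⊗[ℂ] V) ⊗[ℂ] LaurentSeries ℂ} (ht : IsLocal Y x t) (ht' : IsLocal Y x t') :
    t = t' := by
  obtain ⟨K, g, g', ht, ht'⟩ := ht.exists_common ht'
  apply mulBy_injective (isUnit_single K)
  rw [ht.clear, ht'.clear]
  congr 1
  -- Starting from the order 1, 0, 2 makes the exchange end in the identity order, the one in which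
  -- injectivity is available.
  have hsw : swapAt (Equiv.swap 0 1) 0 = 1 := Equiv.swap_mul_self _ _
  apply tensorMap_injective (f := insertPair ![0, 0, c] (castSucc_ne (Equiv.swap 0 1) 0))
    (φ := (diffSubst _ _).toLinearMap) (insertPair_injective hc _ (by decide) (by decide))
    (diffSubst_injective (castSucc_ne (Equiv.swap 0 1) 0))
  rw [← sub_eq_zero]
  refine eq_zero_of_corr_eq_zero Y h _ fun w => ?_
  have e := (ht.exchange (Equiv.swap 0 1) 0 w ![0, 0, c]).symm.trans
    (ht'.exchange (Equiv.swap 0 1) 0 w ![0, 0, c])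
  rw [hsw] at e
  rw [map_sub, e, sub_self]

theorem exists_isLocal (𝒱 : WeakQuantumVertexAlgebra V) (x : V ⊗[ℂ] V) :
    ∃ t, IsLocal 𝒱.Y x t := by
  induction x with
  | zero => exact ⟨0, 0, 0, by simp, by simp⟩
  | add x y hx hy =>
    obtain ⟨s, hs⟩ := hx
    obtain ⟨t, ht⟩ := hy
    exact ⟨_, hs.add ht⟩
  | tmul v u =>
    obtain ⟨r, v', u', f, hf⟩ := 𝒱.jacobi u v
    exact ⟨_, hf.sLocal.isLocal⟩

/-- Locality is additive and homogeneous in the pair, so uniqueness forces any choice of exchanged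
elements to be linear. -/
theorem exists_localityOperator (𝒱 : WeakQuantumVertexAlgebra V)
    (h : Function.Injective (piMap 𝒱.Y 3)) (hvac : 𝒱.vac ≠ 0) :
    ∃ S : V ⊗[ℂ] V →ₗ[ℂ] (V ⊗[ℂ] V) ⊗[ℂ] LaurentSeries ℂ, ∀ x, IsLocal 𝒱.Y x (S x) := by
  choose S hS using exists_isLocal 𝒱
  exact ⟨{ toFun := S
           map_add' := fun x y => (hS _).unique h hvac ((hS x).add (hS y))
           map_smul' := fun c x => (hS _).unique h hvac ((hS x).smul c) }, hS⟩

end Existence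

end

/-! ### Reordering of fields as operators over an algebra A -/

section

section Extend

variable {U U' : Type u} [AddCommGroup U] [Module ℂ U] [AddCommGroup U'] [Module ℂ U']
  {A : Type} [CommRing A] [Algebra ℂ A]

theorem extend_tmul (φ : LaurentSeries ℂ →ₗ[ℂ] A) (T : U →ₗ[ℂ] U ⊗[ℂ] LaurentSeries ℂ) (x : U)
    (a : A) : extend A φ T (x ⊗ₜ a) = mulBy U A a (φ.lTensor U (T x)) := by
  rw [extend, LinearMap.comp_apply, LinearMap.comp_apply, LinearMap.rTensor_tmul,
    LinearMap.comp_apply]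
  induction φ.lTensor U (T x) with
  | zero => simp
  | add s t hs ht => rw [TensorProduct.add_tmul, map_add, map_add, hs, ht, map_add]
  | tmul y b =>
    rw [mulBy_tmul, mul_comm a b]
    rfl

theorem extend_mulBy (φ : LaurentSeries ℂ →ₗ[ℂ] A) (T : U →ₗ[ℂ] U ⊗[ℂ] LaurentSeries ℂ) (a : A)
    (t : U ⊗[ℂ] A) : extend A φ T (mulBy U A a t) = mulBy U A a (extend A φ T t) := by
  induction t with
  | zero => simp
  | add s t hs ht => simp only [map_add, hs, ht]
  | tmul x b => rw [mulBy_tmul, extend_tmul, extend_tmul, mulBy_mul]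

theorem mulBy_comm (a b : A) (t : U ⊗[ℂ] A) :
    mulBy U A a (mulBy U A b t) = mulBy U A b (mulBy U A a t) := by
  rw [← mulBy_mul, mul_comm, mulBy_mul]

end Extend

variable {V U : Type u} [AddCommGroup V] [Module ℂ V] [AddCommGroup U] [Module ℂ U]
  {A : Type} [CommRing A] [Algebra ℂ A]

/-- `Transports` for a single element of `U ⊗ ℂ[[x₀, x₁, x₂]]`. -/
def TransportsAt (Y : V →ₗ[ℂ] VertexOperator ℂ V)
    (κ : U →ₗ[ℂ] PiTensorProduct ℂ (fun _ : Fin 3 => V)) (ρ : MvPowerSeries (Fin 3) ℂ →ₐ[ℂ] A)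
    (σ τ : Equiv.Perm (Fin 3)) (G : U ⊗[ℂ] A →ₗ[ℂ] U ⊗[ℂ] A)
    (t : U ⊗[ℂ] MvPowerSeries (Fin 3) ℂ) : Prop :=
  ∃ (E : MvPowerSeries (Fin 3) ℂ) (t' : U ⊗[ℂ] MvPowerSeries (Fin 3) ℂ), IsUnit (ρ E) ∧
    (∀ w, E • corr Y σ w (κ.rTensor _ t) = corr Y τ w (κ.rTensor _ t')) ∧
    ρ.toLinearMap.lTensor U t' = mulBy U A (ρ E) (G (ρ.toLinearMap.lTensor U t))

/-- Up to a factor `E ∈ ℂ[[x₀, x₁, x₂]]` that is invertible in `A`, reordering the fields from the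
order `σ` to the order `τ` acts on `U ⊗ A` as `G`. -/
def Transports (Y : V →ₗ[ℂ] VertexOperator ℂ V)
    (κ : U →ₗ[ℂ] PiTensorProduct ℂ (fun _ : Fin 3 => V)) (ρ : MvPowerSeries (Fin 3) ℂ →ₐ[ℂ] A)
    (σ τ : Equiv.Perm (Fin 3)) (G : U ⊗[ℂ] A →ₗ[ℂ] U ⊗[ℂ] A) : Prop :=
  ∀ t : U ⊗[ℂ] MvPowerSeries (Fin 3) ℂ, TransportsAt Y κ ρ σ τ G t

variable {Y : V →ₗ[ℂ] VertexOperator ℂ V}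
  {κ : U →ₗ[ℂ] PiTensorProduct ℂ (fun _ : Fin 3 => V)} {ρ : MvPowerSeries (Fin 3) ℂ →ₐ[ℂ] A}
  {σ τ υ : Equiv.Perm (Fin 3)} {G H : U ⊗[ℂ] A →ₗ[ℂ] U ⊗[ℂ] A}

theorem lTensor_mulBy (E : MvPowerSeries (Fin 3) ℂ) (t : U ⊗[ℂ] MvPowerSeries (Fin 3) ℂ) :
    ρ.toLinearMap.lTensor U (mulBy U _ E t) = mulBy U A (ρ E) (ρ.toLinearMap.lTensor U t) :=
  map_mulBy _ _ (fun x => map_mul ρ E x) t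

theorem corr_rTensor_mulBy (w : V) (E : MvPowerSeries (Fin 3) ℂ)
    (t : U ⊗[ℂ] MvPowerSeries (Fin 3) ℂ) :
    corr Y σ w (κ.rTensor _ (mulBy U _ E t)) = E • corr Y σ w (κ.rTensor _ t) := by
  rw [← corr_mulBy]
  exact congrArg _ (map_mulBy _ _ (fun x => rfl) t)

theorem Transports.refl : Transports Y κ ρ σ σ LinearMap.id := fun t =>
  ⟨1, t, by rw [map_one]; exact isUnit_one, fun w => one_smul _ _, by
    rw [map_one, mulBy_one, LinearMap.id_apply]⟩

/-- The clearing factors multiply; linearity of `H` over `A` moves the first factor past it. -/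
theorem Transports.trans (hG : Transports Y κ ρ σ τ G) (hH : Transports Y κ ρ τ υ H)
    (hlin : ∀ a t, H (mulBy U A a t) = mulBy U A a (H t)) :
    Transports Y κ ρ σ υ (H ∘ₗ G) := fun t => by
  obtain ⟨E, t', hE, h1, h2⟩ := hG t
  obtain ⟨E', t'', hE', h1', h2'⟩ := hH t'
  refine ⟨E' * E, t'', by rw [map_mul]; exact hE'.mul hE, fun w => ?_, ?_⟩
  · rw [mul_smul, h1, h1']
  · rw [h2', h2, hlin, map_mul, mulBy_mul, LinearMap.comp_apply]

theorem TransportsAt.zero : TransportsAt Y κ ρ σ τ G 0 :=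
  ⟨1, 0, by rw [map_one]; exact isUnit_one, by simp, by simp⟩

theorem TransportsAt.add {s t : U ⊗[ℂ] MvPowerSeries (Fin 3) ℂ} (hs : TransportsAt Y κ ρ σ τ G s)
    (ht : TransportsAt Y κ ρ σ τ G t) : TransportsAt Y κ ρ σ τ G (s + t) := by
  obtain ⟨E, s', hE, h1, h2⟩ := hs
  obtain ⟨E', t', hE', h1', h2'⟩ := ht
  refine ⟨E' * E, mulBy U _ E' s' + mulBy U _ E t', by rw [map_mul]; exact hE'.mul hE,
    fun w => ?_, ?_⟩
  · rw [map_add, map_add, map_add, map_add, corr_rTensor_mulBy, corr_rTensor_mulBy, ← h1, ← h1',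
      smul_add, mul_smul, smul_smul E E', mul_comm E E', mul_smul E' E (corr Y σ w _)]
  · rw [map_add, lTensor_mulBy, lTensor_mulBy, h2, h2', map_add, map_add, map_add, map_mul,
      mulBy_mul, mulBy_mul, mulBy_comm (ρ E) (ρ E')]

/-- The clearing factor depends on the element, so sums are handled by cross-multiplying
(`TransportsAt.add`), while complex scalars are absorbed into the power series. -/
theorem transports_of_span {B : Set U} (hB : Submodule.span ℂ B = ⊤)
    (h : ∀ x ∈ B, ∀ F, TransportsAt Y κ ρ σ τ G (x ⊗ₜ F)) : Transports Y κ ρ σ τ G := by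
  intro t
  induction t with
  | zero => exact .zero
  | add s t hs ht => exact hs.add ht
  | tmul x F =>
    have hx : x ∈ Submodule.span ℂ B := hB ▸ Submodule.mem_top
    induction hx using Submodule.span_induction generalizing F with
    | mem x hx => exact h x hx F
    | zero => rw [TensorProduct.zero_tmul]; exact .zero
    | add x y _ _ hx hy => rw [TensorProduct.add_tmul]; exact (hx F).add (hy F)
    | smul c x _ hx => rw [TensorProduct.smul_tmul]; exact hx (c • F)

/-- Two ways of reordering the fields give the same operator. -/
theorem Transports.eq (h : Function.Injective (piMap Y 3)) (hκ : Function.Injective κ)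
    (hG : Transports Y κ ρ σ 1 G) (hH : Transports Y κ ρ σ 1 H)
    (hGlin : ∀ a t, G (mulBy U A a t) = mulBy U A a (G t))
    (hHlin : ∀ a t, H (mulBy U A a t) = mulBy U A a (H t)) : G = H := by
  refine TensorProduct.ext' fun x a => ?_
  -- A general `a` need not lie in the image of `ρ`, so compare on `x ⊗ 1` and finish by linearity
  -- over `A`.
  obtain ⟨E, t', hE, h1, h2⟩ := hG (x ⊗ₜ 1)
  obtain ⟨E', t'', hE', h1', h2'⟩ := hH (x ⊗ₜ 1)
  -- Both sides represent, in the identity order, E E' times the same product in the order σ.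
  have key : mulBy U _ E' t' = mulBy U _ E t'' := by
    apply Module.Flat.rTensor_preserves_injective_linearMap κ hκ
    rw [← sub_eq_zero]
    refine eq_zero_of_corr_eq_zero Y h _ fun w => ?_
    rw [map_sub, corr_rTensor_mulBy, corr_rTensor_mulBy, ← h1, ← h1', smul_comm, sub_self]
  have key' := congrArg (ρ.toLinearMap.lTensor U) key
  rw [lTensor_mulBy, lTensor_mulBy, h2, h2', mulBy_comm] at key'
  have e := mulBy_injective hE' (mulBy_injective hE key')
  rw [LinearMap.lTensor_tmul, AlgHom.toLinearMap_apply, map_one] at e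
  have ha : x ⊗ₜ[ℂ] a = mulBy U A a (x ⊗ₜ 1) := by rw [mulBy_tmul, mul_one]
  rw [ha, hGlin, hHlin, e]

/-- `T` acts on `U` as `S` acts on the tensor factors `j` and `i`. -/
def IsPairAction (S : V ⊗[ℂ] V →ₗ[ℂ] (V ⊗[ℂ] V) ⊗[ℂ] LaurentSeries ℂ)
    (κ : U →ₗ[ℂ] PiTensorProduct ℂ (fun _ : Fin 3 => V)) {i j : Fin 3} (hij : i ≠ j)
    (T : U →ₗ[ℂ] U ⊗[ℂ] LaurentSeries ℂ) : Prop :=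
  Submodule.span ℂ {e | ∃ (y : Fin 3 → V) (ins : V ⊗[ℂ] V →ₗ[ℂ] U),
    κ ∘ₗ ins = insertPair y hij ∧ T ∘ₗ ins = ins.rTensor _ ∘ₗ S ∧ e ∈ Set.range ins} = ⊤

/-- A locality witness is exactly such a transport with factor (x_j - x_i)^K. Compatibility of φ
with power series and with multiplication by x suffices, since x^K clears the poles. -/
theorem transports_swapAt {S : V ⊗[ℂ] V →ₗ[ℂ] (V ⊗[ℂ] V) ⊗[ℂ] LaurentSeries ℂ}
    (hS : ∀ x, IsLocal Y x (S x)) {T : U →ₗ[ℂ] U ⊗[ℂ] LaurentSeries ℂ} {l : Fin 2}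
    (hT : IsPairAction S κ (castSucc_ne σ l) T) {φ : LaurentSeries ℂ →ₗ[ℂ] A}
    (hφ : ∀ g, φ (toLaurent g) = ρ (diffSubst (σ l.castSucc) (σ l.succ) g))
    (hφ' : ∀ f, φ (HahnSeries.single 1 1 * f)
      = ρ (diffSubst (σ l.castSucc) (σ l.succ) PowerSeries.X) * φ f)
    (hunit : IsUnit (ρ (diffSubst (σ l.castSucc) (σ l.succ) PowerSeries.X))) :
    Transports Y κ ρ σ (swapAt σ l) (extend A φ T) := by
  refine transports_of_span hT ?_
  rintro _ ⟨y, ins, hκ, hTins, x, rfl⟩ F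
  obtain ⟨K, g, hg⟩ := hS x
  set D := diffSubst (σ l.castSucc) (σ l.succ) with hD
  have hφK (f : LaurentSeries ℂ) (K : ℕ) :
      φ (HahnSeries.single (K : ℤ) 1 * f) = ρ (D (PowerSeries.X ^ K)) * φ f := by
    induction K generalizing f with
    | zero => simp
    | succ K ih =>
      rw [pow_succ, map_mul D, map_mul ρ, mul_assoc, ← hφ', ← ih, ← mul_assoc,
        HahnSeries.single_mul_single, Nat.cast_succ, one_mul]
  refine ⟨D (PowerSeries.X ^ K), mulBy U _ F (TensorProduct.map ins D.toLinearMap g), ?_,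
    fun w => ?_, ?_⟩
  · rw [map_pow, map_pow]
    exact hunit.pow K
  · have h1 : κ.rTensor _ (TensorProduct.map ins D.toLinearMap g)
        = TensorProduct.map (insertPair y (castSucc_ne σ l)) D.toLinearMap g := by
      rw [← hκ, ← LinearMap.rTensor_comp_map]
      rfl
    rw [corr_rTensor_mulBy, h1, ← hg.exchange, LinearMap.rTensor_tmul, ← hκ, ← corr_mulBy,
      ← corr_mulBy, mulBy_tmul, mulBy_tmul, mul_comm]
    rfl
  · have h2 : ρ.toLinearMap.lTensor U (TensorProduct.map ins D.toLinearMap g)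
        = TensorProduct.map ins φ (toLaurent.lTensor _ g) := by
      rw [← LinearMap.comp_apply, ← LinearMap.comp_apply, LinearMap.lTensor_comp_map,
        LinearMap.map_comp_lTensor]
      congr 2
      exact LinearMap.ext fun f => (hφ f).symm
    have h3 : φ.lTensor U (T (ins x)) = TensorProduct.map ins φ (S x) := by
      have := LinearMap.congr_fun hTins x
      rw [LinearMap.comp_apply] at this
      rw [this, LinearMap.comp_apply, ← LinearMap.comp_apply, LinearMap.lTensor_comp_rTensor]
    rw [lTensor_mulBy, h2, ← hg.clear, map_mulBy _ _ (fun f => hφK f K), LinearMap.lTensor_tmul,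
      extend_tmul, h3, mulBy_comm]
    rfl

end

/-! ### S acting on pairs of tensor factors -/

section

section Actions

variable {V : Type u} [AddCommGroup V] [Module ℂ V]
  (S : V ⊗[ℂ] V →ₗ[ℂ] (V ⊗[ℂ] V) ⊗[ℂ] LaurentSeries ℂ)

theorem isPairAction_self (c : V) {i j : Fin 3} (hij : i ≠ j) :
    IsPairAction S (insertPair ![0, 0, c] hij) hij S :=
  Submodule.eq_top_iff'.2 fun x => Submodule.subset_span ⟨![0, 0, c], LinearMap.id, rfl, by
    rw [LinearMap.rTensor_id]; rfl, x, rfl⟩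

/-- The embedding stays the same while the slots exchange roles; this inserts a flip on both sides
of S. -/
theorem isPairAction_S21 (c : V) :
    IsPairAction S (insertPair ![0, 0, c] (by decide : (0 : Fin 3) ≠ 1))
      (by decide : (1 : Fin 3) ≠ 0) (S21 S) :=
  Submodule.eq_top_iff'.2 fun x => Submodule.subset_span ⟨![0, 0, c],
    (TensorProduct.comm ℂ V V).toLinearMap, TensorProduct.ext' fun a b => by
      simp [insertPair_tmul, Function.update_comm], by
      refine TensorProduct.ext' fun a b => ?_
      simp [S21], (TensorProduct.comm ℂ V V).surjective x⟩

theorem span_eq_top_of_triples {B : Set ((V ⊗[ℂ] V) ⊗[ℂ] V)}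
    (h : ∀ a b c : V, (a ⊗ₜ[ℂ] b) ⊗ₜ[ℂ] c ∈ B) : Submodule.span ℂ B = ⊤ := by
  refine Submodule.eq_top_iff'.2 fun t => ?_
  induction t with
  | zero => exact zero_mem _
  | add s t hs ht => exact add_mem hs ht
  | tmul x c =>
    induction x with
    | zero => rw [TensorProduct.zero_tmul]; exact zero_mem _
    | add s t hs ht => rw [TensorProduct.add_tmul]; exact add_mem hs ht
    | tmul a b => exact Submodule.subset_span (h a b c)

theorem S12_tmul (x : V ⊗[ℂ] V) (c : V) :
    S12 S (x ⊗ₜ c) = ((TensorProduct.mk ℂ (V ⊗[ℂ] V) V).flip c).rTensor _ (S x) := by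
  rw [S12, LinearMap.comp_apply, LinearMap.rTensor_tmul]
  induction S x with
  | zero => simp
  | add s t hs ht => rw [TensorProduct.add_tmul, map_add, hs, ht, map_add]
  | tmul p f => rfl

theorem isPairAction_S12 :
    IsPairAction S ofTriple (by decide : (1 : Fin 3) ≠ 0) (S12 S) :=
  span_eq_top_of_triples fun a b c => ⟨![0, 0, c], (TensorProduct.mk ℂ (V ⊗[ℂ] V) V).flip c,
    LinearMap.ext fun _ => rfl, LinearMap.ext fun x => S12_tmul S x c, a ⊗ₜ b, rfl⟩

theorem isPairAction_S13 :
    IsPairAction S ofTriple (by decide : (2 : Fin 3) ≠ 0) (S13 S) :=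
  span_eq_top_of_triples fun a b c => ⟨![0, b, 0],
    (TensorProduct.rightComm ℂ V V V).toLinearMap ∘ₗ (TensorProduct.mk ℂ (V ⊗[ℂ] V) V).flip b,
    TensorProduct.ext' fun a c => by
      have h : Function.update (Function.update ![0, b, 0] 2 c) 0 a = ![a, b, c] := by
        funext i
        fin_cases i <;> simp
      rw [insertPair_tmul, h, ← ofTriple_tmul]
      rfl,
    LinearMap.ext fun x => by
      have h : (TensorProduct.rightComm ℂ V V V) ((TensorProduct.rightComm ℂ V V V) (x ⊗ₜ b))
          = x ⊗ₜ b := by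
        induction x with
        | zero => simp
        | add s t hs ht => rw [TensorProduct.add_tmul, map_add, map_add, hs, ht]
        | tmul p f => rfl
      rw [LinearMap.rTensor_comp, S13]
      simp only [LinearMap.comp_apply, LinearMap.flip_apply, TensorProduct.mk_apply,
        LinearEquiv.coe_coe]
      rw [h, S12_tmul], a ⊗ₜ c, rfl⟩

theorem isPairAction_S23 :
    IsPairAction S ofTriple (by decide : (2 : Fin 3) ≠ 1) (S23 S) :=
  span_eq_top_of_triples fun a b c => ⟨![a, 0, 0],
    (TensorProduct.assoc ℂ V V V).symm.toLinearMap ∘ₗ TensorProduct.mk ℂ V (V ⊗[ℂ] V) a,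
    TensorProduct.ext' fun b c => by
      have h : Function.update (Function.update ![a, 0, 0] 2 c) 1 b = ![a, b, c] := by
        funext i
        fin_cases i <;> simp
      rw [insertPair_tmul, h, ← ofTriple_tmul]
      rfl,
    LinearMap.ext fun x => by
      rw [LinearMap.rTensor_comp, S23]
      simp only [LinearMap.comp_apply, TensorProduct.mk_apply, LinearEquiv.coe_coe,
        LinearEquiv.apply_symm_apply, LinearMap.lTensor_tmul]
      induction S x with
      | zero => simp
      | add s t hs ht => rw [TensorProduct.tmul_add, map_add, map_add, hs, ht, map_add, map_add]
      | tmul p f => rfl, b ⊗ₜ c, rfl⟩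

end Actions

section Reorder

variable {V U : Type u} [AddCommGroup V] [Module ℂ V] [AddCommGroup U] [Module ℂ U]
  {A : Type} [CommRing A] [Algebra ℂ A] {Y : V →ₗ[ℂ] VertexOperator ℂ V}
  {κ : U →ₗ[ℂ] PiTensorProduct ℂ (fun _ : Fin 3 => V)} {ρ : MvPowerSeries (Fin 3) ℂ →ₐ[ℂ] A}

theorem toLaurent_X : toLaurent PowerSeries.X = HahnSeries.single 1 1 :=
  HahnSeries.ofPowerSeries_X

/-- Indexed by the exchanged variables instead of their position, so one pair action can serve in
several orders. -/
theorem Transports.swap {S : V ⊗[ℂ] V →ₗ[ℂ] (V ⊗[ℂ] V) ⊗[ℂ] LaurentSeries ℂ}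
    (hS : ∀ x, IsLocal Y x (S x)) {T : U →ₗ[ℂ] U ⊗[ℂ] LaurentSeries ℂ} {i j : Fin 3} {hij : i ≠ j}
    (hT : IsPairAction S κ hij T) {φ : LaurentSeries ℂ →ₗ[ℂ] A}
    (hφ : ∀ g, φ (toLaurent g) = ρ (diffSubst i j g))
    (hφ' : ∀ f, φ (HahnSeries.single 1 1 * f) = φ (HahnSeries.single 1 1) * φ f)
    (hunit : IsUnit (φ (HahnSeries.single 1 1))) {σ τ : Equiv.Perm (Fin 3)} (l : Fin 2)
    (hi : σ l.castSucc = i) (hj : σ l.succ = j) (hτ : swapAt σ l = τ) :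
    Transports Y κ ρ σ τ (extend A φ T) := by
  subst hi hj hτ
  rw [← toLaurent_X, hφ] at hunit
  refine transports_swapAt hS hT hφ (fun f => ?_) hunit
  rw [← hφ, toLaurent_X, hφ']

end Reorder

end

/-! ### Evaluation of the variables at spectral parameters -/

section

section Evaluation

theorem algebraMap_laurent {A : Type} [CommRing A] [Algebra ℂ A] (c : ℂ) :
    algebraMap ℂ (LaurentSeries A) c = HahnSeries.C (algebraMap ℂ A c) := rfl

theorem substAlgHom_diffSubst {τ : Type} {a : Fin 3 → MvPowerSeries τ ℂ}
    (ha : MvPowerSeries.HasSubst a) (i j : Fin 3) (g : PowerSeries ℂ) :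
    MvPowerSeries.substAlgHom (R := ℂ) ha (diffSubst i j g) = g.subst (a j - a i) := by
  rw [diffSubst, PowerSeries.coe_substAlgHom, MvPowerSeries.coe_substAlgHom, PowerSeries.subst,
    MvPowerSeries.subst_comp_subst_apply (hasSubst_linear 1 (-1) j i).const ha, PowerSeries.subst]
  congr 1
  funext _
  rw [← MvPowerSeries.coe_substAlgHom ha, map_add, map_smul, map_smul,
    MvPowerSeries.substAlgHom_X, MvPowerSeries.substAlgHom_X, one_smul, neg_one_smul,
    sub_eq_add_neg]

/-- The inclusion of `ℂ[[x]]` in `ℂ((x))` as an algebra homomorphism. -/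
def toLaurentAlg : PowerSeries ℂ →ₐ[ℂ] LaurentSeries ℂ :=
  { HahnSeries.ofPowerSeries ℤ ℂ with
    commutes' := fun c => by
      rw [algebraMap_laurent]
      exact HahnSeries.ofPowerSeries_C c }

theorem hasSubst_fin3 {τ : Type} {a : Fin 3 → MvPowerSeries τ ℂ}
    (h : ∀ i, MvPowerSeries.constantCoeff (a i) = 0) : MvPowerSeries.HasSubst a :=
  MvPowerSeries.hasSubst_of_constantCoeff_zero h

theorem hasSubst_singleVar : MvPowerSeries.HasSubst
    (![PowerSeries.X, 0, 0] : Fin 3 → MvPowerSeries Unit ℂ) :=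
  hasSubst_fin3 fun i => by
    fin_cases i
    · exact PowerSeries.constantCoeff_X
    · exact map_zero _
    · exact map_zero _

/-- The evaluation `x₀ ↦ x`, `x₁ ↦ 0`, `x₂ ↦ 0`. -/
def evalX : MvPowerSeries (Fin 3) ℂ →ₐ[ℂ] LaurentSeries ℂ :=
  toLaurentAlg.comp (MvPowerSeries.substAlgHom hasSubst_singleVar : _ →ₐ[ℂ] PowerSeries ℂ)

theorem evalX_diffSubst_one_zero (g : PowerSeries ℂ) : toLaurent g = evalX (diffSubst 1 0 g) := by
  have h : (evalX (diffSubst 1 0 g)) = toLaurentAlg (g.subst (PowerSeries.X - 0 : PowerSeries ℂ)) :=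
    congrArg toLaurentAlg (substAlgHom_diffSubst hasSubst_singleVar 1 0 g)
  rw [h, sub_zero, PowerSeries.X_subst]
  rfl

/-- Here x₁ - x₀ becomes -x; this produces the factor S(-x) in unitarity. -/
theorem evalX_diffSubst_zero_one (g : PowerSeries ℂ) :
    substNeg (toLaurent g) = evalX (diffSubst 0 1 g) := by
  have h : (evalX (diffSubst 0 1 g)) = toLaurentAlg (g.subst (0 - PowerSeries.X : PowerSeries ℂ)) :=
    congrArg toLaurentAlg (substAlgHom_diffSubst hasSubst_singleVar 0 1 g)
  have h' : (0 - PowerSeries.X : PowerSeries ℂ) = (-1 : ℂ) • PowerSeries.X := by simp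
  rw [h, h', ← PowerSeries.rescale_eq_subst]
  ext n
  change (-1) ^ n * (HahnSeries.ofPowerSeries ℤ ℂ g).coeff n
    = (HahnSeries.ofPowerSeries ℤ ℂ _).coeff n
  rw [ofPowerSeries_coeff_int, ofPowerSeries_coeff_int]
  split_ifs with h0
  · obtain ⟨d, rfl⟩ := Int.eq_ofNat_of_zero_le h0
    rw [PowerSeries.coeff_rescale, Int.toNat_natCast, zpow_natCast]
  · rw [mul_zero]

theorem substNeg_single : substNeg (HahnSeries.single 1 1) = HahnSeries.single 1 (-1) := by
  ext n
  change (-1) ^ n * (HahnSeries.single (1 : ℤ) (1 : ℂ)).coeff n = _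
  rw [HahnSeries.coeff_single, HahnSeries.coeff_single]
  split_ifs with h
  · simp [h]
  · simp

theorem substNeg_single_mul (f : LaurentSeries ℂ) :
    substNeg (HahnSeries.single 1 1 * f) = substNeg (HahnSeries.single 1 1) * substNeg f := by
  rw [substNeg_single]
  ext n
  change (-1) ^ n * (HahnSeries.single (1 : ℤ) (1 : ℂ) * f).coeff n = _
  obtain ⟨m, rfl⟩ : ∃ m, n = m + 1 := ⟨n - 1, by ring⟩
  rw [HahnSeries.coeff_single_mul_add, HahnSeries.coeff_single_mul_add,
    zpow_add_one₀ (by norm_num)]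
  change _ = -1 * ((-1) ^ m * f.coeff m)
  ring

/-- The iterated inclusion of `ℂ[[z, x]]` in `ℂ((x))((z))`, where `z` is the variable `0`. -/
def toIterLaurent : MvPowerSeries (Fin 2) ℂ →ₐ[ℂ] LaurentSeries (LaurentSeries ℂ) :=
  { (HahnSeries.ofPowerSeries ℤ (LaurentSeries ℂ)).comp ((PowerSeries.map
      ((HahnSeries.ofPowerSeries ℤ ℂ).comp ((PowerSeries.map
        (MvPowerSeries.constantCoeff (σ := Fin 0) (R := ℂ))).comp
        (MvPowerSeries.finSuccEquiv ℂ 0).toAlgHom.toRingHom))).comp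
      (MvPowerSeries.finSuccEquiv ℂ 1).toAlgHom.toRingHom) with
    commutes' := fun c => by
      have h : algebraMap ℂ (MvPowerSeries (Fin 2) ℂ) c = MvPowerSeries.C c := rfl
      simp [h, algebraMap_laurent, MvPowerSeries.finSuccEquiv_C] }

theorem coeff_toIterLaurent (F : MvPowerSeries (Fin 2) ℂ) (m n : ℤ) :
    ((toIterLaurent F).coeff n).coeff m = if 0 ≤ n ∧ 0 ≤ m then
      MvPowerSeries.coeff (Finsupp.single 1 m.toNat + Finsupp.single 0 n.toNat) F else 0 := by
  change ((HahnSeries.ofPowerSeries ℤ (LaurentSeries ℂ) _).coeff n).coeff m = _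
  rw [ofPowerSeries_coeff_int]
  by_cases hn : 0 ≤ n
  · rw [if_pos hn]
    change (HahnSeries.ofPowerSeries ℤ ℂ _).coeff m = _
    rw [ofPowerSeries_coeff_int]
    by_cases hm : 0 ≤ m
    · rw [if_pos hm, if_pos ⟨hn, hm⟩]
      change MvPowerSeries.coeff 0 (PowerSeries.coeff _ (MvPowerSeries.finSuccEquiv ℂ 0
        (PowerSeries.coeff _ (MvPowerSeries.finSuccEquiv ℂ 1 F)))) = _
      rw [MvPowerSeries.coeff_coeff_finSuccEquiv, MvPowerSeries.coeff_coeff_finSuccEquiv]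
      congr 2
      ext i
      fin_cases i
      · simp
      · simpa using (Finsupp.cons_succ (0 : Fin 1) n.toNat (Finsupp.cons m.toNat 0)).trans
          (Finsupp.cons_zero m.toNat 0)
    · rw [if_neg hm, if_neg (fun h => hm h.2)]
  · rw [if_neg hn, if_neg (fun h => hn h.1)]
    rfl

theorem coeff_toIterLaurent_subst (c d : ℂ) (g : PowerSeries ℂ) (m n : ℤ) :
    ((toIterLaurent (g.subst (c • MvPowerSeries.X 1 + d • MvPowerSeries.X 0 :
      MvPowerSeries (Fin 2) ℂ))).coeff n).coeff m = if 0 ≤ n ∧ 0 ≤ m then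
      g.coeff (m.toNat + n.toNat) *
        (c ^ m.toNat * d ^ n.toNat * (m.toNat + n.toNat).choose m.toNat) else 0 := by
  rw [coeff_toIterLaurent, coeff_subst_linear c d (by decide)]

theorem hasSubst_twoVar : MvPowerSeries.HasSubst (![MvPowerSeries.X 1 + MvPowerSeries.X 0,
    MvPowerSeries.X 0, 0] : Fin 3 → MvPowerSeries (Fin 2) ℂ) :=
  hasSubst_fin3 fun i => by fin_cases i <;> simp

/-- The evaluation `x₀ ↦ x + z`, `x₁ ↦ z`, `x₂ ↦ 0`. -/
def evalXZ : MvPowerSeries (Fin 3) ℂ →ₐ[ℂ] LaurentSeries (LaurentSeries ℂ) :=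
  toIterLaurent.comp (MvPowerSeries.substAlgHom hasSubst_twoVar)

/-- The three differences x₀ - x₁, x₁ - x₂, x₀ - x₂ become x, z, x + z, the arguments in the
Yang–Baxter equation. -/
theorem evalXZ_diffSubst (i j : Fin 3) (g : PowerSeries ℂ) {b : MvPowerSeries (Fin 2) ℂ}
    (h : (![MvPowerSeries.X 1 + MvPowerSeries.X 0, MvPowerSeries.X 0, 0] :
      Fin 3 → MvPowerSeries (Fin 2) ℂ) j - ![MvPowerSeries.X 1 + MvPowerSeries.X 0,
      MvPowerSeries.X 0, 0] i = b) :
    evalXZ (diffSubst i j g) = toIterLaurent (g.subst b) :=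
  congrArg toIterLaurent ((substAlgHom_diffSubst hasSubst_twoVar i j g).trans (by rw [h]))

theorem substX_toLaurent (g : PowerSeries ℂ) : substX (toLaurent g) = evalXZ (diffSubst 1 0 g) := by
  rw [evalXZ_diffSubst (b := (1 : ℂ) • MvPowerSeries.X 1 + (0 : ℂ) • MvPowerSeries.X 0) 1 0 g
    (by simp)]
  refine HahnSeries.ext (funext fun n => HahnSeries.ext (funext fun m => ?_))
  rw [coeff_toIterLaurent_subst]
  change ((HahnSeries.single (0 : ℤ) (toLaurent g)).coeff n).coeff m = _
  rw [HahnSeries.coeff_single]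
  by_cases hn : n = 0
  · subst hn
    rw [if_pos rfl, toLaurent_apply, ofPowerSeries_coeff_int]
    simp
  · rw [if_neg hn]
    by_cases h : 0 ≤ n ∧ 0 ≤ m
    · have : n.toNat ≠ 0 := by omega
      simp [this]
    · rw [if_neg h]
      rfl

theorem substZ_toLaurent (g : PowerSeries ℂ) : substZ (toLaurent g) = evalXZ (diffSubst 2 1 g) := by
  rw [evalXZ_diffSubst (b := (0 : ℂ) • MvPowerSeries.X 1 + (1 : ℂ) • MvPowerSeries.X 0) 2 1 g
    (by simp)]
  refine HahnSeries.ext (funext fun n => HahnSeries.ext (funext fun m => ?_))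
  rw [coeff_toIterLaurent_subst]
  change (HahnSeries.single (0 : ℤ) ((toLaurent g).coeff n)).coeff m = _
  rw [HahnSeries.coeff_single, toLaurent_apply, ofPowerSeries_coeff_int]
  by_cases hm : m = 0
  · subst hm
    simp
  · rw [if_neg hm]
    by_cases h : 0 ≤ n ∧ 0 ≤ m
    · have : m.toNat ≠ 0 := by omega
      simp [this]
    · rw [if_neg h]

theorem substXAddZ_toLaurent (g : PowerSeries ℂ) :
    substXAddZ (toLaurent g) = evalXZ (diffSubst 2 0 g) := by
  rw [evalXZ_diffSubst (b := (1 : ℂ) • MvPowerSeries.X 1 + (1 : ℂ) • MvPowerSeries.X 0) 2 0 g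
    (by simp)]
  refine HahnSeries.ext (funext fun n => HahnSeries.ext (funext fun m => ?_))
  rw [coeff_toIterLaurent_subst]
  change ((HahnSeries.ofPowerSeries ℤ (LaurentSeries ℂ)
    (PowerSeries.mk fun k => LaurentSeries.hasseDeriv ℂ k (toLaurent g))).coeff n).coeff m = _
  rw [ofPowerSeries_coeff_int]
  by_cases hn : 0 ≤ n
  · obtain ⟨b, rfl⟩ := Int.eq_ofNat_of_zero_le hn
    rw [if_pos hn, PowerSeries.coeff_mk, LaurentSeries.hasseDeriv_coeff, toLaurent_apply,
      ofPowerSeries_coeff_int, Int.toNat_natCast]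
    by_cases hm : 0 ≤ m
    · obtain ⟨a, rfl⟩ := Int.eq_ofNat_of_zero_le hm
      rw [if_pos (And.intro hn hm), ← Nat.cast_add, if_pos (Int.natCast_nonneg (a + b)),
        Int.toNat_natCast, Int.toNat_natCast, Ring.choose_natCast, Nat.choose_symm_add,
        zsmul_eq_mul]
      push_cast
      ring
    -- For m < 0 either m + b is negative and the series has no such coefficient, or 0 ≤ m + b < b
    -- and the binomial coefficient vanishes.
    · rw [if_neg (c := 0 ≤ (b : ℤ) ∧ 0 ≤ m) (fun h => hm h.2)]
      split_ifs with h
      · obtain ⟨d, hd⟩ := Int.eq_ofNat_of_zero_le h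
        rw [hd, Ring.choose_natCast, Nat.choose_eq_zero_of_lt (by omega), Nat.cast_zero, zero_smul]
      · rw [smul_zero]
  · rw [if_neg hn, if_neg (fun h => hn h.1)]
    rfl

theorem substX_single_mul (f : LaurentSeries ℂ) :
    substX (HahnSeries.single 1 1 * f) = substX (HahnSeries.single 1 1) * substX f := by
  change HahnSeries.single (0 : ℤ) _ = HahnSeries.single (0 : ℤ) _ * HahnSeries.single (0 : ℤ) _
  rw [HahnSeries.single_mul_single, zero_add]

theorem substZ_single_mul (f : LaurentSeries ℂ) :
    substZ (HahnSeries.single 1 1 * f) = substZ (HahnSeries.single 1 1) * substZ f :=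
  HahnSeries.map_mul ((HahnSeries.C : ℂ →+* LaurentSeries ℂ) : ℂ →ₙ+* LaurentSeries ℂ)

/-- Leibniz rule for multiplication by x, which is Pascal's rule on coefficients; it yields
compatibility of f(x) ↦ f(x + z) with multiplication by x. -/
theorem hasseDeriv_succ_single_mul (f : LaurentSeries ℂ) (k : ℕ) :
    LaurentSeries.hasseDeriv ℂ (k + 1) (HahnSeries.single 1 1 * f)
      = HahnSeries.single 1 1 * LaurentSeries.hasseDeriv ℂ (k + 1) f
        + LaurentSeries.hasseDeriv ℂ k f := by
  ext n
  obtain ⟨m, rfl⟩ : ∃ m, n = m + 1 := ⟨n - 1, by ring⟩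
  rw [HahnSeries.coeff_add, HahnSeries.coeff_single_mul_add, one_mul,
    LaurentSeries.hasseDeriv_coeff, LaurentSeries.hasseDeriv_coeff,
    LaurentSeries.hasseDeriv_coeff]
  have e1 : m + 1 + ((k + 1 : ℕ) : ℤ) = (m + 1 + k) + 1 := by push_cast; ring
  have e2 : m + ((k + 1 : ℕ) : ℤ) = m + 1 + k := by push_cast; ring
  rw [e1, HahnSeries.coeff_single_mul_add, one_mul, e2, Ring.choose_succ_succ, add_smul, add_comm]

theorem substXAddZ_single : substXAddZ (HahnSeries.single 1 1) = HahnSeries.ofPowerSeries ℤ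
    (LaurentSeries ℂ) (PowerSeries.C (HahnSeries.single 1 1) + PowerSeries.X) := by
  change HahnSeries.ofPowerSeries ℤ (LaurentSeries ℂ) _ = _
  congr 1
  refine PowerSeries.ext fun k => ?_
  rw [PowerSeries.coeff_mk, map_add, PowerSeries.coeff_C, PowerSeries.coeff_X,
    LaurentSeries.hasseDeriv_single]
  match k with
  | 0 => simp
  | 1 => simp
  | k + 2 =>
    have : Ring.choose (1 : ℤ) (k + 2) = 0 := by
      have := Ring.choose_natCast (R := ℤ) 1 (k + 2)
      simpa [Nat.choose_eq_zero_of_lt (show 1 < k + 2 by omega)] using this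
    simp [this]

theorem substXAddZ_single_mul (f : LaurentSeries ℂ) :
    substXAddZ (HahnSeries.single 1 1 * f)
      = substXAddZ (HahnSeries.single 1 1) * substXAddZ f := by
  rw [substXAddZ_single]
  change HahnSeries.ofPowerSeries ℤ (LaurentSeries ℂ) _
    = _ * HahnSeries.ofPowerSeries ℤ (LaurentSeries ℂ) _
  rw [← map_mul]
  congr 1
  refine PowerSeries.ext fun k => ?_
  rw [add_mul, map_add, PowerSeries.coeff_C_mul, PowerSeries.coeff_mk, PowerSeries.coeff_mk]
  cases k with
  | zero => simp
  | succ k => rw [PowerSeries.coeff_succ_X_mul, PowerSeries.coeff_mk, hasseDeriv_succ_single_mul]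

theorem isUnit_of_coeff_ne_zero {F : Type} [Field F] {f : LaurentSeries F} {n : ℤ}
    (h : f.coeff n ≠ 0) : IsUnit f :=
  Ne.isUnit fun hf => h (by rw [hf]; rfl)

theorem isUnit_substNeg_single : IsUnit (substNeg (HahnSeries.single 1 1)) := by
  refine isUnit_of_coeff_ne_zero (n := 1) ?_
  rw [substNeg_single, HahnSeries.coeff_single_same]
  exact neg_ne_zero.2 one_ne_zero

theorem isUnit_substX_single : IsUnit (substX (HahnSeries.single 1 1)) := by
  refine isUnit_of_coeff_ne_zero (n := 0) ?_
  change (HahnSeries.single (0 : ℤ) (HahnSeries.single (1 : ℤ) (1 : ℂ))).coeff 0 ≠ 0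
  rw [HahnSeries.coeff_single_same]
  exact HahnSeries.single_ne_zero one_ne_zero

theorem isUnit_substZ_single : IsUnit (substZ (HahnSeries.single 1 1)) := by
  refine isUnit_of_coeff_ne_zero (n := 1) ?_
  change HahnSeries.C ((HahnSeries.single (1 : ℤ) (1 : ℂ)).coeff 1) ≠ (0 : LaurentSeries ℂ)
  rw [HahnSeries.coeff_single_same]
  exact HahnSeries.C_ne_zero one_ne_zero

theorem isUnit_substXAddZ_single : IsUnit (substXAddZ (HahnSeries.single 1 1)) := by
  refine isUnit_of_coeff_ne_zero (n := 1) ?_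
  rw [substXAddZ_single, ofPowerSeries_coeff_int]
  simp

end Evaluation

end

/-! ### Unitarity, the Yang–Baxter equation and the quantum vertex algebra structure -/

section

section YangBaxterOperator

variable {V : Type u} [AddCommGroup V] [Module ℂ V] {Y : V →ₗ[ℂ] VertexOperator ℂ V}
  {S : V ⊗[ℂ] V →ₗ[ℂ] (V ⊗[ℂ] V) ⊗[ℂ] LaurentSeries ℂ}

/-- Exchanging the first two fields and exchanging them back returns to the identity order, as does
doing nothing. -/
theorem unitary_of_isLocal (h : Function.Injective (piMap Y 3)) (hS : ∀ x, IsLocal Y x (S x))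
    {c : V} (hc : c ≠ 0) :
    extend (LaurentSeries ℂ) LinearMap.id (S21 S) ∘ₗ extend (LaurentSeries ℂ) substNeg S
      = LinearMap.id := by
  have h1 := Transports.swap (κ := insertPair ![0, 0, c] (by decide : (0 : Fin 3) ≠ 1))
    (ρ := evalX) hS (isPairAction_self ..) evalX_diffSubst_zero_one substNeg_single_mul
    isUnit_substNeg_single (σ := 1) 0 rfl rfl rfl
  have h2 := Transports.swap (κ := insertPair ![0, 0, c] (by decide : (0 : Fin 3) ≠ 1))
    (ρ := evalX) hS (isPairAction_S21 ..) (φ := LinearMap.id) evalX_diffSubst_one_zero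
    (fun f => rfl) (isUnit_single 1) (σ := swapAt 1 0) (τ := 1) 0 (by decide) (by decide)
    (by decide)
  exact (h1.trans h2 (extend_mulBy _ _)).eq h
    (insertPair_injective hc _ (by decide) (by decide)) .refl
    (fun a t => by simp only [LinearMap.comp_apply, extend_mulBy]) (fun _ _ => rfl)

theorem yang_baxter_of_isLocal (h : Function.Injective (piMap Y 3))
    (hS : ∀ x, IsLocal Y x (S x)) :
    extend (LaurentSeries (LaurentSeries ℂ)) substX (S12 S) ∘ₗ
        extend (LaurentSeries (LaurentSeries ℂ)) substXAddZ (S13 S) ∘ₗ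
        extend (LaurentSeries (LaurentSeries ℂ)) substZ (S23 S)
      = extend (LaurentSeries (LaurentSeries ℂ)) substZ (S23 S) ∘ₗ
        extend (LaurentSeries (LaurentSeries ℂ)) substXAddZ (S13 S) ∘ₗ
        extend (LaurentSeries (LaurentSeries ℂ)) substX (S12 S) := by
  have h12 {σ τ : Equiv.Perm (Fin 3)} (l : Fin 2) (hi : σ l.castSucc = 1) (hj : σ l.succ = 0)
      (hτ : swapAt σ l = τ) :
      Transports (A := LaurentSeries (LaurentSeries ℂ)) Y ofTriple evalXZ σ τ
        (extend _ substX (S12 S)) :=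
    .swap (A := LaurentSeries (LaurentSeries ℂ)) hS (isPairAction_S12 S)
      substX_toLaurent substX_single_mul isUnit_substX_single l hi hj hτ
  have h13 {σ τ : Equiv.Perm (Fin 3)} (l : Fin 2) (hi : σ l.castSucc = 2) (hj : σ l.succ = 0)
      (hτ : swapAt σ l = τ) :
      Transports (A := LaurentSeries (LaurentSeries ℂ)) Y ofTriple evalXZ σ τ
        (extend _ substXAddZ (S13 S)) :=
    .swap (A := LaurentSeries (LaurentSeries ℂ)) hS (isPairAction_S13 S)
      substXAddZ_toLaurent substXAddZ_single_mul isUnit_substXAddZ_single l hi hj hτ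
  have h23 {σ τ : Equiv.Perm (Fin 3)} (l : Fin 2) (hi : σ l.castSucc = 2) (hj : σ l.succ = 1)
      (hτ : swapAt σ l = τ) :
      Transports (A := LaurentSeries (LaurentSeries ℂ)) Y ofTriple evalXZ σ τ
        (extend _ substZ (S23 S)) :=
    .swap (A := LaurentSeries (LaurentSeries ℂ)) hS (isPairAction_S23 S)
      substZ_toLaurent substZ_single_mul isUnit_substZ_single l hi hj hτ
  -- The orders run 210, 120, 102, 012.
  have left := ((h23 (σ := Equiv.swap 0 2) 0 (by decide) (by decide) rfl).trans
    (h13 1 (by decide) (by decide) rfl) (extend_mulBy _ _)).trans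
    (h12 (τ := 1) 0 (by decide) (by decide) (by decide)) (extend_mulBy _ _)
  -- The other route from 210 to 012, through 201 and 021.
  have right := ((h12 (σ := Equiv.swap 0 2) 1 (by decide) (by decide) rfl).trans
    (h13 0 (by decide) (by decide) rfl) (extend_mulBy _ _)).trans
    (h23 (τ := 1) 1 (by decide) (by decide) (by decide)) (extend_mulBy _ _)
  exact left.eq h ofTriple_injective right
    (fun a t => by simp only [LinearMap.comp_apply, extend_mulBy])
    (fun a t => by simp only [LinearMap.comp_apply, extend_mulBy])

theorem subsingleton_tensorProduct {M N : Type*} [AddCommGroup M] [Module ℂ M] [AddCommGroup N]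
    [Module ℂ N] [Subsingleton M] : Subsingleton (M ⊗[ℂ] N) :=
  subsingleton_of_forall_eq 0 fun t => by
    induction t with
    | zero => rfl
    | add s t hs ht => rw [hs, ht, add_zero]
    | tmul x y => rw [Subsingleton.elim x 0, TensorProduct.zero_tmul]

/-- Existence and uniqueness of the quantum vertex algebra structure. -/
theorem exists_unique_operator (𝒱 : WeakQuantumVertexAlgebra V)
    (h : Function.Injective (piMap 𝒱.Y 3)) :
    ∃ S : V ⊗[ℂ] V →ₗ[ℂ] (V ⊗[ℂ] V) ⊗[ℂ] LaurentSeries ℂ,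
      IsQuantumVertexAlgebra 𝒱 S ∧ (∀ S', IsQuantumVertexAlgebra 𝒱 S' → S' = S) ∧
      (∀ (u v : V) (r : ℕ) (v' u' : Fin r → V) (f : Fin r → LaurentSeries ℂ),
        SLocal 𝒱.Y u v v' u' f → S (v ⊗ₜ u) = ∑ i, (v' i ⊗ₜ u' i) ⊗ₜ f i) := by
  -- A zero vacuum forces V = 0 by the creation property. Otherwise the vacuum serves as the nonzero
  -- vector in the third slot.
  by_cases hvac : 𝒱.vac = 0
  · have : Subsingleton V := subsingleton_of_forall_eq 0 fun v => by
      rw [← 𝒱.creation v, hvac, map_zero]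
    have : Subsingleton (V ⊗[ℂ] V) := subsingleton_tensorProduct
    have : Subsingleton ((V ⊗[ℂ] V) ⊗[ℂ] V) := subsingleton_tensorProduct
    have (U A : Type _) [AddCommGroup U] [Module ℂ U] [Subsingleton U] [CommRing A] [Algebra ℂ A] :
        Subsingleton (U ⊗[ℂ] A →ₗ[ℂ] U ⊗[ℂ] A) :=
      have : Subsingleton (U ⊗[ℂ] A) := subsingleton_tensorProduct
      ⟨fun f g => LinearMap.ext fun x => Subsingleton.elim _ _⟩
    have hx : Subsingleton ((V ⊗[ℂ] V) ⊗[ℂ] LaurentSeries ℂ) := subsingleton_tensorProduct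
    refine ⟨0, ⟨⟨Subsingleton.elim _ _, Subsingleton.elim _ _⟩, fun u v => ?_⟩,
      fun S' _ => LinearMap.ext fun x => Subsingleton.elim _ _,
      fun u v r v' u' f _ => Subsingleton.elim _ _⟩
    obtain ⟨r, v', u', f, hJ⟩ := 𝒱.jacobi u v
    exact ⟨r, v', u', f, Subsingleton.elim _ _, hJ⟩
  · obtain ⟨S, hS⟩ := exists_localityOperator 𝒱 h hvac
    have hloc (u v : V) (r : ℕ) (v' u' : Fin r → V) (f : Fin r → LaurentSeries ℂ)
        (hl : SLocal 𝒱.Y u v v' u' f) : S (v ⊗ₜ u) = ∑ i, (v' i ⊗ₜ u' i) ⊗ₜ f i :=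
      IsLocal.unique h hvac (hS _) hl.isLocal
    refine ⟨S, ⟨⟨unitary_of_isLocal h hS hvac, yang_baxter_of_isLocal h hS⟩, fun u v => ?_⟩,
      fun S' hS' => TensorProduct.ext' fun v u => ?_, hloc⟩
    -- The element in the given Jacobi identity is local, hence equals S(v ⊗ u).
    · obtain ⟨r, v', u', f, hJ⟩ := 𝒱.jacobi u v
      exact ⟨r, v', u', f, hloc u v r v' u' f hJ.sLocal, hJ⟩
    -- Any competing operator satisfies the Jacobi identity, hence locality, which S already
    -- determines.
    · obtain ⟨r, v', u', f, he, hJ⟩ := hS'.jacobi u v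
      rw [he, hloc u v r v' u' f hJ.sLocal]

/-- The map in the definition of nondegeneracy is πₙ followed by evaluation at the vacuum. -/
theorem IsNondegenerate.piMap_injective {vac : V} (h : IsNondegenerate Y vac) {n : ℕ}
    (hn : 1 ≤ n) : Function.Injective (piMap Y n) := fun _ _ hst =>
  h n hn (LinearMap.congr_fun hst vac)

end YangBaxterOperator

end

end QVA

end

theorem theorem5p11 {V : Type*} [AddCommGroup V] [Module ℂ V]
    (𝒱 : QVA.WeakQuantumVertexAlgebra V) :
    (Function.Injective (QVA.piMap 𝒱.Y 3) →
      ∃ S : V ⊗[ℂ] V →ₗ[ℂ] (V ⊗[ℂ] V) ⊗[ℂ] LaurentSeries ℂ,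
        QVA.IsQuantumVertexAlgebra 𝒱 S ∧
        (∀ S', QVA.IsQuantumVertexAlgebra 𝒱 S' → S' = S) ∧
        (∀ (u v : V) (r : ℕ) (v' u' : Fin r → V) (f : Fin r → LaurentSeries ℂ),
          QVA.SLocal 𝒱.Y u v v' u' f → S (v ⊗ₜ u) = ∑ i, (v' i ⊗ₜ u' i) ⊗ₜ f i)) ∧
    (QVA.IsNondegenerate 𝒱.Y 𝒱.vac →
      ∃ S : V ⊗[ℂ] V →ₗ[ℂ] (V ⊗[ℂ] V) ⊗[ℂ] LaurentSeries ℂ,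
        QVA.IsQuantumVertexAlgebra 𝒱 S ∧
        (∀ S', QVA.IsQuantumVertexAlgebra 𝒱 S' → S' = S) ∧
        (∀ (u v : V) (r : ℕ) (v' u' : Fin r → V) (f : Fin r → LaurentSeries ℂ),
          QVA.SLocal 𝒱.Y u v v' u' f → S (v ⊗ₜ u) = ∑ i, (v' i ⊗ₜ u' i) ⊗ₜ f i)) := by
  exact ⟨QVA.exists_unique_operator 𝒱,
    fun h => QVA.exists_unique_operator 𝒱 (h.piMap_injective (by norm_num))⟩
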